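/- Let $d\ge 1$, $\gamma,J>0$. Put $$v=4(2d-1)J,\qquad \xi=25\Bigl(1+\frac{v^2}{\gamma^2}\Bigr),$$ $$C_1=\Bigl(\frac{2^{d+2}}{\sqrt{\pi}\sqrt{\gamma^2+v^2}}+\frac{2v}{\gamma}+3^{d+2}4^{2d}d^{\,d-1}\Bigr)\frac{(2dJ)^2}{v},\qquad C_2=\frac{4C_1}{\sqrt{\pi}\sqrt{\gamma^2+v^2}}+3,$$ $$C_3=\frac{4^dJ}{v}\Bigl(\frac{2v}{\sqrt{\pi}\sqrt{\gamma^2+v^2}}+4^d+\frac{2v}{\gamma^2+v^2}\,C_1\Bigr),\qquad C(\gamma,d,J)=C_2+C_3.$$ Let $V\subset\mathbb{Z}^d$ be finite, with the $\ell^1$ distance $d(x,y)=\sum_i|x_i-y_i|$, and attach to each $x\in V$ a Hilbert space $\mathbb{C}^{n_x}$. For $X\subset V$ let $\mathcal{A}_X$ be the algebra of operators on $\bigotimes_{x\in V}\mathbb{C}^{n_x}$ of the form $a\otimes 1_{V\setminus X}$. Let $H_V=\sum_{X\subset V}\Phi(X)$, where $\Phi(X)=\Phi(X)^*\in\mathcal{A}_X$,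 $\|\Phi(X)\|\le J$ in operator norm, and $\Phi(X)=0$ whenever $X$ has diameter greater than $1$. Suppose that $H_V$ has a unique normalized ground state $\Psi_0$ (up to phase), with a spectral gap of at least $\gamma$: the lowest eigenvalue $E_0$ of $H_V$ is simple and every other eigenvalue is at least $E_0+\gamma$. Let $P_0=|\Psi_0\rangle\langle\Psi_0|$. For $A\subset V$ let $\partial A=\{x\in A:\exists\,y\in V\setminus A,\ d(x,y)\le1\}$ and $B(A;\ell)=\{x\in V:\exists\,y\in\partial A,\ d(x,y)\le\ell\}$. **Theorem.** There is an absolute constant $c_0>0$ such that, for all data as above, every $A\subset V$ and every real $\ell\ge c_0\,d^2\xi^2$, there exist orthogonal projections $P_A\in\mathcal{A}_A$ and $P_{V\setminus A}\in\mathcal{A}_{V\setminus A}$ and an operator $P_B\in\mathcal{A}_{B(A;\ell)}$ with $\|P_B\|\le1$ such that $$\|P_BP_AP_{V\setminus A}-P_0\|\le C(\gamma,d,J)\,|\partial A|^2\,e^{-\ell/\xi}.$$ -/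

import Mathlib

open scoped Kronecker Matrix.Norms.L2Operator

namespace SpinLattice

noncomputable section

/-- The `ℓ¹` (graph) distance on `ℤ^d`. -/
def latticeDist {d : ℕ} (x y : Fin d → ℤ) : ℕ := ∑ i, (x i - y i).natAbs

section Geometry

variable {d : ℕ} {V : Finset (Fin d → ℤ)}

/-- The diameter `max {d(x,y) | x, y ∈ X}` of a region `X ⊆ V` (it is `0` for the empty region). -/
def diam (X : Finset V) : ℕ := X.sup fun x => X.sup fun y => latticeDist x.1 y.1

open Classical in
/-- The boundary `∂A = {x ∈ A | ∃ y ∈ V ∖ A, d(x,y) ≤ 1}`. -/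
def boundary (A : Finset V) : Finset V :=
  A.filter fun x => ∃ y : V, y ∉ A ∧ latticeDist x.1 y.1 ≤ 1

open Classical in
/-- The `ℓ`-boundary `B(A;ℓ) = {x ∈ V | ∃ y ∈ ∂A, d(x,y) ≤ ℓ}`. -/
def boundaryNhd (A : Finset V) (ℓ : ℝ) : Finset V :=
  Finset.univ.filter fun x => ∃ y ∈ boundary A, (latticeDist x.1 y.1 : ℝ) ≤ ℓ

end Geometry

section Observables

variable {d : ℕ} {V : Finset (Fin d → ℤ)}

/-- Labels of the product basis of `⨂_{x ∈ V} ℂ^{n x}`; the Hilbert space of the whole system is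
`EuclideanSpace ℂ (Config n)`. -/
abbrev Config (n : V → ℕ) : Type := (x : V) → Fin (n x)

/-- Operators on the Hilbert space of the whole system, as matrices in the product basis. The norm
is the operator norm. -/
abbrev Observable (n : V → ℕ) : Type := Matrix (Config n) (Config n) ℂ

/-- `a ↦ a ⊗ 1_{V ∖ X}`, for an operator `a` on `⨂_{x ∈ X} ℂ^{n x}`. -/
def localEmbed (n : V → ℕ) (X : Finset V)
    (a : Matrix ((x : {x : V // x ∈ X}) → Fin (n x)) ((x : {x : V // x ∈ X}) → Fin (n x)) ℂ) :
    Observable n :=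
  (a ⊗ₖ (1 : Matrix ((x : {x : V // x ∉ X}) → Fin (n x))
      ((x : {x : V // x ∉ X}) → Fin (n x)) ℂ)).submatrix
    (Equiv.piEquivPiSubtypeProd (fun x : V => x ∈ X) fun x => Fin (n x))
    (Equiv.piEquivPiSubtypeProd (fun x : V => x ∈ X) fun x => Fin (n x))

/-- The local algebra `𝒜_X ⊆ 𝒜_V` of observables supported on `X`. -/
def localAlgebra (n : V → ℕ) (X : Finset V) : Set (Observable n) := Set.range (localEmbed n X)

/-- An interaction of range `1` and strength at most `J`. -/
structure IsInteraction (n : V → ℕ) (Φ : Finset V → Observable n) (J : ℝ) : Prop where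
  selfAdjoint : ∀ X, IsSelfAdjoint (Φ X)
  mem_local : ∀ X, Φ X ∈ localAlgebra n X
  norm_le : ∀ X, ‖Φ X‖ ≤ J
  range_one : ∀ X, 1 < diam X → Φ X = 0

/-- The Hamiltonian `H_V = ∑_{X ⊆ V} Φ(X)`. -/
def hamiltonian {n : V → ℕ} (Φ : Finset V → Observable n) : Observable n := ∑ X : Finset V, Φ X

end Observables

/-- `ψ` is a normalized vector spanning the eigenspace of a self-adjoint `H` for an eigenvalue `E₀`,
and every other eigenvalue is at least `E₀ + γ`: for `γ > 0`, `ψ` is the unique (up to phase)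
normalized ground state and `H` has a spectral gap (at least) `γ` above it. -/
def IsGappedGroundState {ι : Type*} [Fintype ι] [DecidableEq ι]
    (H : Matrix ι ι ℂ) (ψ : EuclideanSpace ℂ ι) (γ : ℝ) : Prop :=
  ‖ψ‖ = 1 ∧ ∃ E₀ : ℝ,
    Module.End.eigenspace (Matrix.toEuclideanLin H) (E₀ : ℂ) = Submodule.span ℂ {ψ} ∧
    ∀ E : ℝ, Module.End.HasEigenvalue (Matrix.toEuclideanLin H) (E : ℂ) → E ≠ E₀ → E₀ + γ ≤ E

/-- The operator `|ψ⟩⟨ψ|`; for a unit vector, the orthogonal projection onto `ψ`. -/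
def rankOneProj {ι : Type*} (ψ : EuclideanSpace ℂ ι) : Matrix ι ι ℂ :=
  Matrix.vecMulVec (fun i => ψ i) (fun i => star (ψ i))

/-- The Lieb-Robinson velocity `v = 4(2d-1)J`. -/
def velocity (d : ℕ) (J : ℝ) : ℝ := 4 * (2 * (d : ℝ) - 1) * J

/-- The decay length `ξ = 25 (1 + (v/γ)²)`. -/
def decayLength (γ : ℝ) (d : ℕ) (J : ℝ) : ℝ := 25 * (1 + (velocity d J / γ) ^ 2)

/-- `C₁(γ,d,J)`. -/
def const₁ (γ : ℝ) (d : ℕ) (J : ℝ) : ℝ :=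
  (2 ^ (d + 2) / (√Real.pi * √(γ ^ 2 + velocity d J ^ 2)) + 2 * velocity d J / γ
      + 3 ^ (d + 2) * 4 ^ (2 * d) * (d : ℝ) ^ (d - 1))
    * ((2 * (d : ℝ) * J) ^ 2 / velocity d J)

/-- `C₂(γ,d,J)`. -/
def const₂ (γ : ℝ) (d : ℕ) (J : ℝ) : ℝ :=
  4 * const₁ γ d J / (√Real.pi * √(γ ^ 2 + velocity d J ^ 2)) + 3

/-- `C₃(γ,d,J)`. -/
def const₃ (γ : ℝ) (d : ℕ) (J : ℝ) : ℝ :=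
  4 ^ d * J / velocity d J
    * (2 * velocity d J / (√Real.pi * √(γ ^ 2 + velocity d J ^ 2)) + 4 ^ d
      + 2 * velocity d J / (γ ^ 2 + velocity d J ^ 2) * const₁ γ d J)

/-- The prefactor `C(γ,d,J) = C₂ + C₃`. -/
def prefactor (γ : ℝ) (d : ℕ) (J : ℝ) : ℝ := const₂ γ d J + const₃ γ d J

end

end SpinLattice

/-!
The ground state projection `P₀` of a gapped Hamiltonian `H` (ground state energy shifted to `0`) is
a filtered evolution: averaging `e^{itH}` over a probability measure on `[-T, T]` whose Fourier
transform is small on `[γ, ∞)` gives `P₀` up to `e^{-γT/2}`. The measure used is a Gaussian of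
variance `T / γ` conditioned to `[-T, T]` (`exists_filter`, `norm_integral_expI_sub_kerProj_le`).
The Lieb–Robinson bound (`lieb_robinson`, `IsInteraction.lieb_robinson`) limits how far an
observable spreads within that time. It is proved by Grönwall's inequality for the whole family of
commutators `‖[τ_t(Φ(Z)), W]‖`, weighted by `e^{dist}`, and it turns into approximation by local
observables through an average over signed permutations of the basis off a region
(`exists_mem_localAlgebra_of_norm_lie_le`).

Split `H = H_I + H_E + H_B`, where `H_I` and `H_E` consist of the terms at depth more than `m`
inside `A` and inside its complement, and `H_B` of the terms near the boundary; constants are added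
so that `H_I` and `H_E` have ground state expectation `0`. The time averages `K_I`, `K_E` and `K_B`
of the three parts over the evolution of `H` still add up to `H`. By the gap, `K_I` and `K_E` nearly
annihilate the ground state (`norm_timeAverage_mul_le`). The commutators `[H, H_I]` and `[H, H_E]`
live near depth `m`, so `K_I` and `K_E` are close to `M_I ∈ 𝒜_A` and `M_E ∈ 𝒜_{V ∖ A}`. The
projections `P_A` and `P_{V ∖ A}` are the spectral projections of `M_I` and `M_E` at `[-a, a]`: by
Chebyshev's inequality they nearly fix the ground state. On the range of their product
`e^{-it(K_I + K_E)}` is nearly `1`, hence `P₀`, as an average of `e^{itH}`, is close there to the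
average of `e^{itH} e^{-it(K_I + K_E)}`. The latter product of unitaries is generated by
`τ_t(H - K_I - K_E) = τ_t(K_B)`, so it is localized near the boundary, and localizing its average
gives `P_B`. This is `norm_mul_spectralProj_sub_le`, and `exists_approx` with all the errors.

With cut-offs of order `ℓ / (γ ξ)`, every error is at most `e^{-1.1 ℓ / ξ}` times polynomial factors
in `ℓ` of degree `d + 2`. As `ℓ ≥ c₀ d² ξ²`, the surplus `e^{-0.1 ℓ / ξ}` absorbs these factors
(`volume_factor_le_exp`), and what is left of the prefactor is the `3` contained in `C₂`. If `∂A` is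
empty, the right-hand side is `0`; then `H_I` and `H_E` commute and `P₀` is exactly the product of
their eigenprojections (`exists_mul_eq_rankOneProj_of_boundary_eq_empty`).
-/

namespace SpinLattice

/-! ### Dynamics in a C*-algebra and the Lieb–Robinson bound -/

section Dynamics

open Complex

variable {𝒜 : Type*} [CStarAlgebra 𝒜]

/-- The one-parameter group `t ↦ e^{itH}`. -/
noncomputable def expI (H : 𝒜) (t : ℝ) : 𝒜 := NormedSpace.exp (t • (I • H))

/-- The Heisenberg evolution `τ_t(a) = e^{itH} a e^{-itH}`. -/
noncomputable def heis (H : 𝒜) (t : ℝ) (a : 𝒜) : 𝒜 := expI H t * a * expI H (-t)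

lemma hasDerivAt_expI (H : 𝒜) (t : ℝ) : HasDerivAt (expI H) (expI H t * (I • H)) t :=
  hasDerivAt_exp_smul_const (I • H) t

lemma continuous_expI (H : 𝒜) : Continuous (expI H) :=
  continuous_iff_continuousAt.2 fun t => (hasDerivAt_expI H t).continuousAt

@[simp] lemma expI_zero (H : 𝒜) : expI H 0 = 1 := by simp [expI]

lemma expI_add (H : 𝒜) (s t : ℝ) : expI H (s + t) = expI H s * expI H t := by
  let _ : NormedAlgebra ℚ 𝒜 := NormedAlgebra.restrictScalars ℚ ℂ 𝒜
  rw [expI, expI, expI, add_smul]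
  exact NormedSpace.exp_add_of_commute (((Commute.refl (I • H)).smul_left s).smul_right t)

@[simp] lemma expI_mul_expI_neg (H : 𝒜) (t : ℝ) : expI H t * expI H (-t) = 1 := by
  rw [← expI_add]; simp

@[simp] lemma expI_neg_mul_expI (H : 𝒜) (t : ℝ) : expI H (-t) * expI H t = 1 := by
  rw [← expI_add]; simp

lemma expI_neg_left (H : 𝒜) (t : ℝ) : expI (-H) t = expI H (-t) := by
  simp [expI]

lemma star_expI {H : 𝒜} (hH : IsSelfAdjoint H) (t : ℝ) : star (expI H t) = expI H (-t) := by
  let _ : NormedAlgebra ℚ 𝒜 := NormedAlgebra.restrictScalars ℚ ℂ 𝒜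
  rw [expI, NormedSpace.star_exp, expI]
  simp [hH.star_eq]

lemma expI_mem_unitary {H : 𝒜} (hH : IsSelfAdjoint H) (t : ℝ) : expI H t ∈ unitary 𝒜 := by
  rw [Unitary.mem_iff, star_expI hH]
  simp

lemma commute_expI {a H : 𝒜} (h : Commute a H) (t : ℝ) : Commute a (expI H t) := by
  let _ : NormedAlgebra ℚ 𝒜 := NormedAlgebra.restrictScalars ℚ ℂ 𝒜
  exact ((h.smul_right I).smul_right t).exp_right

lemma expI_add_smul_one (H : 𝒜) (c t : ℝ) :
    expI (H + (c : ℂ) • 1) t = expI ((c : ℂ) • (1 : 𝒜)) t * expI H t := by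
  let _ : NormedAlgebra ℚ 𝒜 := NormedAlgebra.restrictScalars ℚ ℂ 𝒜
  rw [expI, expI, expI, ← NormedSpace.exp_add_of_commute, smul_add, smul_add, add_comm]
  exact ((((Commute.one_left H).smul_left _).smul_right I).smul_left _ |>.smul_left _).smul_right _

lemma norm_heis {H : 𝒜} (hH : IsSelfAdjoint H) (t : ℝ) (a : 𝒜) : ‖heis H t a‖ = ‖a‖ := by
  rw [heis, CStarRing.norm_mul_mem_unitary _ (expI_mem_unitary hH _),
    CStarRing.norm_mem_unitary_mul _ (expI_mem_unitary hH _)]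

@[simp] lemma heis_zero (H : 𝒜) (a : 𝒜) : heis H 0 a = a := by simp [heis]

lemma heis_eq_self {H a : 𝒜} (h : Commute a H) (t : ℝ) : heis H t a = a := by
  rw [heis, ← (commute_expI h t).eq, mul_assoc, expI_mul_expI_neg, mul_one]

lemma heis_self (H : 𝒜) (t : ℝ) : heis H t H = H := heis_eq_self (Commute.refl H) t

lemma heis_neg_left (H : 𝒜) (t : ℝ) (a : 𝒜) : heis (-H) t a = heis H (-t) a := by
  simp [heis, expI_neg_left]

lemma heis_mul (H : 𝒜) (t : ℝ) (a b : 𝒜) : heis H t (a * b) = heis H t a * heis H t b := by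
  simp only [heis]
  calc expI H t * (a * b) * expI H (-t)
      = expI H t * a * 1 * b * expI H (-t) := by simp only [mul_one, mul_assoc]
    _ = _ := by rw [← expI_neg_mul_expI H t]; simp only [mul_assoc]

lemma heis_sub (H : 𝒜) (t : ℝ) (a b : 𝒜) : heis H t (a - b) = heis H t a - heis H t b := by
  simp only [heis, mul_sub, sub_mul]

lemma heis_add_right (H : 𝒜) (t : ℝ) (a b : 𝒜) :
    heis H t (a + b) = heis H t a + heis H t b := by
  simp only [heis, mul_add, add_mul]

lemma heis_smul (H : 𝒜) (t : ℝ) (c : ℂ) (a : 𝒜) : heis H t (c • a) = c • heis H t a := by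
  simp [heis]

lemma heis_one (H : 𝒜) (t : ℝ) : heis H t 1 = 1 := by simp [heis]

lemma heis_sum {κ : Type*} (H : 𝒜) (t : ℝ) (s : Finset κ) (f : κ → 𝒜) :
    heis H t (∑ k ∈ s, f k) = ∑ k ∈ s, heis H t (f k) := by
  simp only [heis, Finset.mul_sum, Finset.sum_mul]

lemma heis_lie (H : 𝒜) (t : ℝ) (a b : 𝒜) : heis H t ⁅a, b⁆ = ⁅heis H t a, heis H t b⁆ := by
  simp only [Ring.lie_def, heis_sub, heis_mul]

lemma heis_heis (H : 𝒜) (s t : ℝ) (a : 𝒜) : heis H s (heis H t a) = heis H (s + t) a := by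
  simp only [heis, expI_add, neg_add_rev, mul_assoc]

lemma star_heis {H : 𝒜} (hH : IsSelfAdjoint H) (t : ℝ) (a : 𝒜) :
    star (heis H t a) = heis H t (star a) := by
  simp [heis, star_expI hH, mul_assoc]

lemma heis_add_smul_one (H : 𝒜) (c t : ℝ) (a : 𝒜) :
    heis (H + (c : ℂ) • 1) t a = heis H t a := by
  have hc : ∀ b : 𝒜, Commute b (expI ((c : ℂ) • (1 : 𝒜)) t) := fun b =>
    commute_expI ((Commute.one_right b).smul_right _) t
  rw [heis, heis, expI_add_smul_one, expI_add_smul_one, ← (hc _).eq]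
  calc expI H t * expI ((c : ℂ) • (1 : 𝒜)) t * a * (expI ((c : ℂ) • (1 : 𝒜)) (-t) * expI H (-t))
      = expI H t * (expI ((c : ℂ) • (1 : 𝒜)) t * a) * expI ((c : ℂ) • (1 : 𝒜)) (-t)
          * expI H (-t) := by simp only [mul_assoc]
    _ = expI H t * a * (expI ((c : ℂ) • (1 : 𝒜)) t * expI ((c : ℂ) • (1 : 𝒜)) (-t))
          * expI H (-t) := by rw [← (hc a).eq]; simp only [mul_assoc]
    _ = _ := by rw [expI_mul_expI_neg, mul_one]

lemma hasDerivAt_heis (H : 𝒜) (a : 𝒜) (t : ℝ) :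
    HasDerivAt (fun s => heis H s a) (heis H t (I • ⁅H, a⁆)) t := by
  have h1 := ((hasDerivAt_expI H t).mul_const a).mul
    ((hasDerivAt_expI H (-t)).scomp t (hasDerivAt_neg t))
  refine h1.congr_deriv ?_
  have h2 : expI H (-t) * (I • H) = (I • H) * expI H (-t) :=
    ((commute_expI ((Commute.refl H).smul_left I) (-t)).eq).symm
  simp only [h2, heis, Ring.lie_def, Function.comp, neg_smul, one_smul, smul_sub, mul_sub, sub_mul,
    smul_mul_assoc, mul_smul_comm, mul_neg, mul_assoc]
  abel

lemma continuous_heis (H : 𝒜) (a : 𝒜) : Continuous fun t => heis H t a :=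
  continuous_iff_continuousAt.2 fun t => (hasDerivAt_heis H a t).continuousAt

lemma neg_lie_left (a b : 𝒜) : ⁅-a, b⁆ = -⁅a, b⁆ := by
  simp [Ring.lie_def]; abel

lemma sum_lie_left {κ : Type*} (s : Finset κ) (f : κ → 𝒜) (b : 𝒜) :
    ⁅∑ k ∈ s, f k, b⁆ = ∑ k ∈ s, ⁅f k, b⁆ := by
  simp only [Ring.lie_def, Finset.mul_sum, Finset.sum_mul, Finset.sum_sub_distrib]

lemma norm_lie_le (a b : 𝒜) : ‖⁅a, b⁆‖ ≤ 2 * ‖a‖ * ‖b‖ := by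
  rw [Ring.lie_def]
  calc ‖a * b - b * a‖ ≤ ‖a * b‖ + ‖b * a‖ := norm_sub_le _ _
    _ ≤ ‖a‖ * ‖b‖ + ‖b‖ * ‖a‖ := add_le_add (norm_mul_le _ _) (norm_mul_le _ _)
    _ = _ := by ring

lemma norm_lie_heis {H : 𝒜} (hH : IsSelfAdjoint H) (t : ℝ) (a b : 𝒜) :
    ‖⁅heis H t a, b⁆‖ = ‖⁅a, heis H (-t) b⁆‖ := by
  rw [← norm_heis hH t ⁅a, heis H (-t) b⁆, heis_lie, heis_heis]; simp

/-- Mean value inequality for a curve in a normed space. -/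
lemma norm_sub_le_of_hasDerivAt {E : Type*} [NormedAddCommGroup E] [NormedSpace ℝ E]
    {f f' : ℝ → E} {C t : ℝ} (hf : ∀ s, HasDerivAt f (f' s) s)
    (hC : ∀ s, |s| ≤ |t| → ‖f' s‖ ≤ C) : ‖f t - f 0‖ ≤ C * |t| := by
  have h := (convex_Icc (-|t|) |t|).norm_image_sub_le_of_norm_hasDerivWithin_le
    (f := f) (f' := f') (C := C) (x := 0) (y := t) (fun x _ => (hf x).hasDerivWithinAt)
    (fun x hx => hC x (abs_le.2 hx)) ⟨by simp, by simp⟩ ⟨neg_abs_le t, le_abs_self t⟩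
  simpa using h

/-- Evolving forward with `K` what was evolved back with `H` only sees `H - K`. -/
lemma hasDerivAt_heis_heis (H K W : 𝒜) (t : ℝ) :
    HasDerivAt (fun s => heis K s (heis H (-s) W))
      (heis K t (-(I • ⁅H - K, heis H (-t) W⁆))) t := by
  have h1 : HasDerivAt (fun s => heis H (-s) W) (-(I • ⁅H, heis H (-t) W⁆)) t := by
    refine ((hasDerivAt_heis H W (-t)).scomp t (hasDerivAt_neg t)).congr_deriv ?_
    rw [heis_smul, heis_lie, heis_self]; simp
  have h3 := ((hasDerivAt_expI K t).mul h1).mul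
    ((hasDerivAt_expI K (-t)).scomp t (hasDerivAt_neg t))
  refine h3.congr_deriv ?_
  have h4 : expI K (-t) * (I • K) = (I • K) * expI K (-t) :=
    ((commute_expI ((Commute.refl K).smul_left I) (-t)).eq).symm
  set G := heis H (-t) W
  simp only [Function.comp, Pi.mul_apply, neg_smul, one_smul, h4, heis]
  change _ * expI K (-t) + (expI K t * G) * _ = _
  simp only [Ring.lie_def, smul_sub, mul_sub, sub_mul, neg_sub, mul_neg, add_mul,
    smul_mul_assoc, mul_smul_comm, mul_assoc]
  abel

/-- The Lieb–Robinson bound for non-negative times, by Grönwall's inequality for the vector of all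
weighted commutators in the supremum norm. -/
theorem lieb_robinson_of_nonneg {κ : Type*} [Fintype κ] (h : κ → 𝒜)
    (hsa : ∀ k, IsSelfAdjoint (h k)) (W : 𝒜) (nbr : κ → Finset κ)
    (hcomm : ∀ k, ∀ j ∉ nbr k, Commute (h k) (h j)) (w : κ → ℝ) {J u C : ℝ}
    (hu0 : 0 ≤ u) (hJ : ∀ k, ‖h k‖ ≤ J)
    (hu : ∀ k, h k ≠ 0 → 2 * J * ∑ j ∈ nbr k, Real.exp (w k - w j) ≤ u)
    (hC : ∀ k, Real.exp (w k) * ‖⁅h k, W⁆‖ ≤ C) (k : κ) {t : ℝ} (ht : 0 ≤ t) :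
    ‖⁅heis (∑ j, h j) t (h k), W⁆‖ ≤ C * Real.exp (u * t - w k) := by
  classical
  set H := ∑ j, h j with hHdef
  have hH : IsSelfAdjoint H := by
    rw [hHdef, isSelfAdjoint_iff, star_sum]; exact Finset.sum_congr rfl fun j _ => hsa j
  have hJ0 : 0 ≤ J := (norm_nonneg _).trans (hJ k)
  have hC0 : 0 ≤ C := (by positivity : (0:ℝ) ≤ _).trans (hC k)
  let H₀ : κ → 𝒜 := fun k => ∑ j ∈ (nbr k)ᶜ, h j
  have hH₀ : ∀ k, IsSelfAdjoint (H₀ k) := fun k => by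
    rw [isSelfAdjoint_iff, star_sum]; exact Finset.sum_congr rfl fun j _ => hsa j
  have hsub : ∀ k, H - H₀ k = ∑ j ∈ nbr k, h j := fun k => by
    rw [sub_eq_iff_eq_add, hHdef, Finset.sum_add_sum_compl]
  have hcomm₀ : ∀ k, Commute (h k) (H₀ k) := fun k =>
    Commute.sum_right _ _ _ fun j hj => hcomm k j (by simpa using hj)
  -- Evolving back with `H₀ k`, which commutes with `h k`, does not change the norm of the
  -- commutator, and leaves only the neighbouring terms in the derivative.
  let f : ℝ → κ → 𝒜 := fun s k => Real.exp (w k) • ⁅h k, heis (H₀ k) s (heis H (-s) W)⁆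
  let f' : ℝ → κ → 𝒜 := fun s k =>
    Real.exp (w k) • ⁅h k, heis (H₀ k) s (-(I • ⁅H - H₀ k, heis H (-s) W⁆))⁆
  have hf : ∀ s, HasDerivAt f (f' s) s := fun s => by
    rw [hasDerivAt_pi]
    intro k
    have h1 := hasDerivAt_heis_heis H (H₀ k) W s
    exact ((h1.const_mul (h k)).sub (h1.mul_const (h k))).const_smul (Real.exp (w k))
  have hfn : ∀ s k, ‖f s k‖ = Real.exp (w k) * ‖⁅h k, heis H (-s) W⁆‖ := fun s k => by
    have h1 : ⁅h k, heis (H₀ k) s (heis H (-s) W)⁆ = heis (H₀ k) s ⁅h k, heis H (-s) W⁆ := by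
      rw [heis_lie, heis_eq_self (hcomm₀ k)]
    simp only [f, h1, norm_smul, norm_heis (hH₀ k), Real.norm_eq_abs, Real.abs_exp]
  have hf'n : ∀ s, ‖f' s‖ ≤ u * ‖f s‖ := fun s => by
    refine (pi_norm_le_iff_of_nonneg (by positivity)).2 fun k => ?_
    by_cases hk : h k = 0
    · have : f' s k = 0 := by simp [f', hk, Ring.lie_def]
      rw [this, norm_zero]; positivity
    have h1 : ∀ j, ‖⁅h j, heis H (-s) W⁆‖ ≤ Real.exp (-w j) * ‖f s‖ := fun j => by
      have h2 := norm_le_pi_norm (f s) j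
      rw [hfn] at h2
      calc ‖⁅h j, heis H (-s) W⁆‖
          = Real.exp (-w j) * (Real.exp (w j) * ‖⁅h j, heis H (-s) W⁆‖) := by
            rw [← mul_assoc, ← Real.exp_add]; simp
        _ ≤ _ := by gcongr
    calc ‖f' s k‖ ≤ Real.exp (w k) * (2 * J * ∑ j ∈ nbr k, ‖⁅h j, heis H (-s) W⁆‖) := by
          simp only [f', norm_smul, Real.norm_eq_abs, Real.abs_exp]
          gcongr
          refine (norm_lie_le _ _).trans ?_
          rw [norm_heis (hH₀ k), norm_neg, norm_smul, Complex.norm_I, one_mul, hsub, sum_lie_left]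
          gcongr
          · exact hJ k
          · exact norm_sum_le _ _
      _ ≤ Real.exp (w k) * (2 * J * ∑ j ∈ nbr k, Real.exp (-w j) * ‖f s‖) := by
          gcongr with j hj; exact h1 j
      _ = (2 * J * ∑ j ∈ nbr k, Real.exp (w k - w j)) * ‖f s‖ := by
          simp only [sub_eq_add_neg, Real.exp_add, Finset.mul_sum, Finset.sum_mul]
          exact Finset.sum_congr rfl fun j _ => by ring
      _ ≤ u * ‖f s‖ := by gcongr; exact hu k hk
  have h0 : ‖f 0‖ ≤ C := by
    refine (pi_norm_le_iff_of_nonneg hC0).2 fun k => ?_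
    rw [hfn]; simpa using hC k
  have key := norm_le_gronwallBound_of_norm_deriv_right_le (f := f) (f' := f') (δ := C) (K := u)
    (ε := 0) (a := 0) (b := t) (fun s _ => (hf s).continuousAt.continuousWithinAt)
    (fun s _ => (hf s).hasDerivWithinAt) h0 (fun s _ => by simpa using hf'n s) t ⟨ht, le_rfl⟩
  rw [gronwallBound_ε0, sub_zero] at key
  have h2 := (norm_le_pi_norm (f t) k).trans key
  rw [hfn, ← norm_lie_heis hH] at h2
  calc ‖⁅heis H t (h k), W⁆‖
      = Real.exp (-w k) * (Real.exp (w k) * ‖⁅heis H t (h k), W⁆‖) := by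
        rw [← mul_assoc, ← Real.exp_add]; simp
    _ ≤ Real.exp (-w k) * (C * Real.exp (u * t)) := by gcongr
    _ = _ := by rw [sub_eq_add_neg, Real.exp_add]; ring

/-- **Lieb–Robinson bound.** The interaction terms are `h k`, `nbr k` contains every term that does
not commute with `h k`, and `w` is a weight which measures the distance from the term to the
support of `W`. -/
theorem lieb_robinson {κ : Type*} [Fintype κ] (h : κ → 𝒜)
    (hsa : ∀ k, IsSelfAdjoint (h k)) (W : 𝒜) (nbr : κ → Finset κ)
    (hcomm : ∀ k, ∀ j ∉ nbr k, Commute (h k) (h j)) (w : κ → ℝ) {J u C : ℝ}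
    (hu0 : 0 ≤ u) (hJ : ∀ k, ‖h k‖ ≤ J)
    (hu : ∀ k, h k ≠ 0 → 2 * J * ∑ j ∈ nbr k, Real.exp (w k - w j) ≤ u)
    (hC : ∀ k, Real.exp (w k) * ‖⁅h k, W⁆‖ ≤ C) (k : κ) (t : ℝ) :
    ‖⁅heis (∑ j, h j) t (h k), W⁆‖ ≤ C * Real.exp (u * |t| - w k) := by
  rcases le_total 0 t with ht | ht
  · rw [abs_of_nonneg ht]
    exact lieb_robinson_of_nonneg h hsa W nbr hcomm w hu0 hJ hu hC k ht
  · rw [abs_of_nonpos ht]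
    have key := lieb_robinson_of_nonneg (fun k => -h k) (fun k => (hsa k).neg) W nbr
      (fun k j hj => (hcomm k j hj).neg_left.neg_right) w hu0 (by simpa using hJ)
      (by simpa using hu) (by simpa [neg_lie_left] using hC) k (neg_nonneg.2 ht)
    rw [Finset.sum_neg_distrib, heis_neg_left, neg_neg] at key
    have : heis (∑ j, h j) t (-h k) = -heis (∑ j, h j) t (h k) := by simp [heis]
    rwa [this, neg_lie_left, norm_neg] at key

end Dynamics

/-! ### A compactly supported filter -/

section Filter

open Complex MeasureTheory ProbabilityTheory

lemma hasSubgaussianMGF_gaussianReal (v : NNReal) :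
    HasSubgaussianMGF id v (gaussianReal 0 v) where
  integrable_exp_mul t := integrable_exp_mul_gaussianReal t
  mgf_le t := by
    rw [mgf_gaussianReal (μ := 0) (v := v) (by simp)]; simp

/-- The Gaussian of variance `T / γ`, conditioned to `[-T, T]`: the tail that is cut off and the
Fourier transform beyond the gap are both of order `e^{-γT/2}`. -/
theorem exists_filter {γ T : ℝ} (hγ : 0 < γ) (hT : 4 ≤ γ * T) :
    ∃ ν : Measure ℝ, IsProbabilityMeasure ν ∧ (∀ᵐ t ∂ν, |t| ≤ T) ∧
      ∀ ω : ℝ, γ ≤ ω → ‖∫ t : ℝ, Complex.exp (ω * t * I) ∂ν‖ ≤ 5 * Real.exp (-(γ * T / 2)) := by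
  have hT0 : 0 < T := by
    by_contra h
    nlinarith [not_lt.1 h]
  set v : NNReal := ⟨T / γ, by positivity⟩ with hv
  have hv0 : (v : ℝ) = T / γ := rfl
  set μ := gaussianReal 0 v with hμ
  set s := Set.Icc (-T) T with hs
  set x := Real.exp (-(γ * T / 2)) with hx
  have hx2 : x ≤ 0.14 := by
    have h1 : x ≤ Real.exp (-2) := Real.exp_le_exp.2 (by linarith)
    have h2 : (7.3 : ℝ) ≤ Real.exp 2 := by
      have := Real.exp_one_gt_d9
      have h3 : Real.exp 2 = Real.exp 1 * Real.exp 1 := by rw [← Real.exp_add]; norm_num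
      rw [h3]; nlinarith
    rw [Real.exp_neg] at h1
    refine h1.trans ?_
    rw [inv_le_comm₀ (by positivity) (by norm_num)]
    refine le_trans (by norm_num) h2
  have hexp : -T ^ 2 / (2 * (v : ℝ)) = -(γ * T / 2) := by
    rw [hv0]; field_simp
  have htail : μ.real sᶜ ≤ 2 * x := by
    have h1 := (hasSubgaussianMGF_gaussianReal v).measure_ge_le hT0.le
    have h2 := (hasSubgaussianMGF_gaussianReal v).neg.measure_ge_le hT0.le
    rw [hexp] at h1 h2
    refine (measureReal_mono (s₂ := {ω | T ≤ id ω} ∪ {ω | T ≤ (-id) ω}) ?_).trans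
      ((measureReal_union_le _ _).trans (by linarith))
    intro y hy
    by_cases h : T ≤ y
    · exact Or.inl h
    · right
      simp only [hs, Set.mem_compl_iff, Set.mem_Icc, not_and_or, not_le] at hy
      rcases hy with hy | hy
      · simp only [Set.mem_ofPred_eq, Pi.neg_apply, id]; linarith
      · exact absurd hy.le h
  have hms : MeasurableSet s := measurableSet_Icc
  have hmass : 1 - 2 * x ≤ μ.real s := by
    rw [measureReal_compl hms] at htail
    simp at htail ⊢; linarith
  have hs0 : μ s ≠ 0 := fun h => by
    rw [measureReal_def, h] at hmass; simp at hmass; linarith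
  refine ⟨μ[|s], cond_isProbabilityMeasure hs0, ?_, ?_⟩
  · filter_upwards [ae_cond_mem hms] with t ht using abs_le.2 ht
  · intro ω hω
    have hint : Integrable (fun t : ℝ => Complex.exp (ω * t * I)) μ := by
      refine Integrable.of_bound (C := 1) (by fun_prop) (.of_forall fun t => ?_)
      rw [← Complex.ofReal_mul, Complex.norm_exp_ofReal_mul_I]
    have hfull : ‖∫ t : ℝ, Complex.exp (ω * t * I) ∂μ‖ ≤ x := by
      rw [← charFun_apply_real, charFun_gaussianReal, Complex.norm_exp]
      refine Real.exp_le_exp.2 ?_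
      have h1 : ((ω : ℂ) * (0 : ℝ) * I - v * (ω : ℂ) ^ 2 / 2).re = -((v : ℝ) * ω ^ 2 / 2) := by
        rw [show ((ω : ℂ) * (0 : ℝ) * I - v * (ω : ℂ) ^ 2 / 2) =
          ((-((v : ℝ) * ω ^ 2 / 2) : ℝ) : ℂ) by push_cast; ring, Complex.ofReal_re]
      rw [h1, hv0]
      have h2 : γ ^ 2 ≤ ω ^ 2 := by gcongr
      have h3 : γ * T = T / γ * γ ^ 2 := by field_simp
      have h4 : T / γ * γ ^ 2 ≤ T / γ * ω ^ 2 := by gcongr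
      linarith
    have hcut : ‖∫ t in s, Complex.exp (ω * t * I) ∂μ‖ ≤ 3 * x := by
      have h1 := integral_add_compl hms hint
      have h2 : ‖∫ t in sᶜ, Complex.exp (ω * t * I) ∂μ‖ ≤ 1 * μ.real sᶜ := by
        refine norm_setIntegral_le_of_norm_le_const (measure_lt_top _ _) fun t _ => ?_
        rw [← Complex.ofReal_mul, Complex.norm_exp_ofReal_mul_I]
      rw [eq_sub_of_add_eq h1]
      refine (norm_sub_le _ _).trans ?_
      linarith
    rw [ProbabilityTheory.cond, integral_smul_measure, norm_smul, ENNReal.toReal_inv, norm_inv,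
      ← measureReal_def, Real.norm_of_nonneg measureReal_nonneg, inv_mul_le_iff₀ (by linarith)]
    have hx0 : 0 < x := Real.exp_pos _
    nlinarith

end Filter

/-! ### Spectral projections and filtered evolutions -/

section Spectral

open Complex MeasureTheory ProbabilityTheory

variable {𝒜 : Type*} [CStarAlgebra 𝒜]

/-- The spectral projection of a self-adjoint element at the value `0`. -/
noncomputable def kerProj (H : 𝒜) : 𝒜 := cfc (fun z : ℂ => if z = 0 then 1 else 0) H

lemma expI_eq_cfc {H : 𝒜} (hH : IsSelfAdjoint H) (t : ℝ) :
    expI H t = cfc (fun z : ℂ => Complex.exp (z * t * I)) H := by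
  have hn : IsStarNormal H := hH.isStarNormal
  have h1 : t • (I • H) = cfc (fun z : ℂ => z * t * I) H := by
    have : (fun z : ℂ => z * t * I) = fun z : ℂ => (t * I) • id z := by
      ext z; simp; ring
    rw [this, cfc_smul (t * I : ℂ) id H (by fun_prop), cfc_id ℂ H, mul_smul]
    simp
  have hn' : IsStarNormal (t • (I • H)) := by rw [h1]; exact cfc_predicate _ _
  rw [expI, ← CFC.complex_exp_eq_normedSpace_exp (a := t • (I • H)) hn', h1,
    ← cfc_comp' Complex.exp _ H (by fun_prop) (by fun_prop)]

lemma spectrum_complex_eq_re {H : 𝒜} (hH : IsSelfAdjoint H) {z : ℂ} (hz : z ∈ spectrum ℂ H) :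
    z = z.re ∧ z.re ∈ spectrum ℝ H := by
  have h1 : z = z.re := hH.mem_spectrum_eq_re hz
  refine ⟨h1, ?_⟩
  rw [h1] at hz
  simpa [spectrum.algebraMap_mem_iff] using
    (spectrum.algebraMap_mem_iff ℂ (R := ℝ) (a := H) (r := z.re)).1 (by simpa using hz)

lemma isStarProjection_cfc {H : 𝒜} [IsStarNormal H] (hfin : (spectrum ℂ H).Finite)
    (p : ℂ → Prop) [DecidablePred p] :
    IsStarProjection (cfc (fun z : ℂ => if p z then 1 else 0) H) := by
  constructor
  · rw [IsIdempotentElem, ← cfc_mul _ _ H (hfin.continuousOn _) (hfin.continuousOn _)]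
    congr 1; ext z; split_ifs <;> simp
  · rw [isSelfAdjoint_iff, ← cfc_star]
    congr 1; ext z; split_ifs <;> simp

lemma mul_kerProj {H : 𝒜} (hH : IsSelfAdjoint H) (hfin : (spectrum ℂ H).Finite) :
    H * kerProj H = 0 := by
  have hn : IsStarNormal H := hH.isStarNormal
  rw [kerProj]
  nth_rw 1 [← cfc_id' ℂ H]
  rw [← cfc_mul _ _ H (hfin.continuousOn _) (hfin.continuousOn _), ← cfc_zero ℂ H]
  congr 1; ext z; by_cases h : z = 0 <;> simp [h]

/-- The reduced resolvent inverts a self-adjoint element off its kernel, and is bounded by the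
inverse of the spectral gap. -/
theorem exists_resolvent {H : 𝒜} (hH : IsSelfAdjoint H) (hfin : (spectrum ℂ H).Finite) :
    ∃ R : 𝒜, R * H = 1 - kerProj H ∧
      ∀ γ : ℝ, 0 < γ → (∀ x ∈ spectrum ℝ H, x = 0 ∨ γ ≤ x) → ‖R‖ ≤ 1 / γ := by
  have hn : IsStarNormal H := hH.isStarNormal
  have hid : cfc (fun z : ℂ => z) H = H := cfc_id' ℂ H
  refine ⟨cfc (fun z : ℂ => z⁻¹) H, ?_, fun γ hγ hgap => ?_⟩
  · nth_rw 2 [← hid]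
    rw [← cfc_mul _ _ H (hfin.continuousOn _) (hfin.continuousOn _), ← cfc_one ℂ H, kerProj,
      ← cfc_sub _ _ H (hfin.continuousOn _) (hfin.continuousOn _)]
    congr 1; ext z; by_cases h : z = 0 <;> simp [h]
  · refine norm_cfc_le (by positivity) fun z hz => ?_
    obtain ⟨h1, h2⟩ := spectrum_complex_eq_re hH hz
    rw [h1, norm_inv, one_div]
    rcases hgap _ h2 with h3 | h3
    · rw [h3]; simpa using hγ.le
    · rw [Complex.norm_real, Real.norm_of_nonneg (hγ.le.trans h3)]
      gcongr

/-- Averaging `e^{itH}` over a filter gives the ground state projection up to the size of the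
Fourier transform of the filter beyond the gap. -/
theorem norm_integral_expI_sub_kerProj_le {H : 𝒜} (hH : IsSelfAdjoint H)
    (hfin : (spectrum ℂ H).Finite) {γ η : ℝ} (hη : 0 ≤ η)
    (hgap : ∀ x ∈ spectrum ℝ H, x = 0 ∨ γ ≤ x) (ν : Measure ℝ) [IsProbabilityMeasure ν]
    (hν : ∀ ω : ℝ, γ ≤ ω → ‖∫ t : ℝ, Complex.exp (ω * t * I) ∂ν‖ ≤ η) :
    ‖∫ t, expI H t ∂ν - kerProj H‖ ≤ η := by
  have hn : IsStarNormal H := hH.isStarNormal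
  have h1 : ∫ t, expI H t ∂ν =
      cfc (fun z : ℂ => ∫ t : ℝ, Complex.exp (z * t * I) ∂ν) H := by
    rw [cfc_integral (fun (t : ℝ) (z : ℂ) => Complex.exp (z * t * I)) (fun _ => 1) H]
    · simp only [expI_eq_cfc hH]
    · simp only [Function.uncurry_def]; fun_prop
    · refine .of_forall fun t z hz => ?_
      rw [(spectrum_complex_eq_re hH hz).1, ← Complex.ofReal_mul, Complex.norm_exp_ofReal_mul_I]
    · exact hasFiniteIntegral_const _
  rw [h1, kerProj, ← cfc_sub _ _ H (hfin.continuousOn _) (hfin.continuousOn _)]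
  refine norm_cfc_le hη fun z hz => ?_
  obtain ⟨h2, h3⟩ := spectrum_complex_eq_re hH hz
  rcases hgap _ h3 with h4 | h4
  · rw [h2, h4]; simpa using hη
  · by_cases h5 : z = 0
    · subst h5; simpa using hη
    · rw [if_neg h5, sub_zero, h2]; exact hν _ h4

/-- The spectral projection of a self-adjoint `M` at `[-a, a]`. -/
noncomputable def spectralProj (a : ℝ) (M : 𝒜) : 𝒜 :=
  cfc (fun z : ℂ => if ‖z‖ ≤ a then 1 else 0) M

theorem norm_mul_spectralProj_le {M : 𝒜} (hM : IsSelfAdjoint M) (hfin : (spectrum ℂ M).Finite)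
    {a : ℝ} (ha : 0 ≤ a) : ‖M * spectralProj a M‖ ≤ a := by
  have hn : IsStarNormal M := hM.isStarNormal
  have hid : cfc (fun z : ℂ => z) M = M := cfc_id' ℂ M
  rw [spectralProj]
  nth_rw 1 [← hid]
  rw [← cfc_mul _ _ M (hfin.continuousOn _) (hfin.continuousOn _)]
  refine norm_cfc_le ha fun z _ => ?_
  split_ifs with h <;> simpa using by assumption

/-- Chebyshev's inequality for spectral projections. -/
theorem norm_one_sub_spectralProj_mul_le {M : 𝒜} (hM : IsSelfAdjoint M)
    (hfin : (spectrum ℂ M).Finite) {a : ℝ} (ha : 0 < a) (P : 𝒜) :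
    ‖(1 - spectralProj a M) * P‖ ≤ ‖M * P‖ / a := by
  have hn : IsStarNormal M := hM.isStarNormal
  have hid : cfc (fun z : ℂ => z) M = M := cfc_id' ℂ M
  have h1 : 1 - spectralProj a M = cfc (fun z : ℂ => if ‖z‖ ≤ a then 0 else z⁻¹) M * M := by
    nth_rw 3 [← hid]
    rw [← cfc_mul _ _ M (hfin.continuousOn _) (hfin.continuousOn _), ← cfc_one ℂ M, spectralProj,
      ← cfc_sub _ _ M (hfin.continuousOn _) (hfin.continuousOn _)]
    congr 1; ext z
    by_cases h : ‖z‖ ≤ a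
    · simp [h]
    · have hz : z ≠ 0 := fun h0 => h (by simp [h0, ha.le])
      simp [h, hz]
  have h2 : ‖cfc (fun z : ℂ => if ‖z‖ ≤ a then 0 else z⁻¹) M‖ ≤ a⁻¹ := by
    refine norm_cfc_le (by positivity) fun z _ => ?_
    split_ifs with h
    · simpa using ha.le
    · rw [norm_inv]; gcongr; exact (not_le.1 h).le
  rw [h1, mul_assoc, div_eq_inv_mul]
  exact (norm_mul_le _ _).trans (by gcongr)

end Spectral

/-! ### Time averages and the abstract approximation -/

section Core

open Complex MeasureTheory ProbabilityTheory

variable {𝒜 : Type*} [CStarAlgebra 𝒜]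

lemma integrable_of_continuous_of_bound {f : ℝ → 𝒜} (hf : Continuous f) {C : ℝ}
    (hC : ∀ t, ‖f t‖ ≤ C) (ν : Measure ℝ) [IsProbabilityMeasure ν] : Integrable f ν :=
  Integrable.of_bound hf.aestronglyMeasurable C (.of_forall hC)

lemma norm_le_one_of_mem_unitary {U : 𝒜} (hU : U ∈ unitary 𝒜) : ‖U‖ ≤ 1 := by
  rw [← mul_one U, CStarRing.norm_mem_unitary_mul _ hU]
  exact (IsStarProjection.one 𝒜).norm_le

lemma norm_integral_le_of_ae_le {f : ℝ → 𝒜} {C : ℝ} {ν : Measure ℝ} [IsProbabilityMeasure ν]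
    (hC : ∀ᵐ t ∂ν, ‖f t‖ ≤ C) : ‖∫ t, f t ∂ν‖ ≤ C := by
  simpa using norm_integral_le_of_norm_le_const hC

lemma lie_integral_left {f : ℝ → 𝒜} {ν : Measure ℝ} (hf : Integrable f ν) (W : 𝒜) :
    ⁅∫ t, f t ∂ν, W⁆ = ∫ t, ⁅f t, W⁆ ∂ν := by
  simp only [Ring.lie_def]
  rw [integral_sub (hf.mul_const W) (hf.const_mul W), integral_mul_const_of_integrable hf,
    integral_const_mul_of_integrable hf]

lemma expI_mul_of_mul_eq_zero {H P : 𝒜} (h : H * P = 0) (t : ℝ) : expI H t * P = P := by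
  have h1 := norm_sub_le_of_hasDerivAt (C := 0) (t := t)
    (fun s => (hasDerivAt_expI H s).mul_const P) (fun s _ => by simp [mul_assoc, h])
  simpa [sub_eq_zero] using h1

lemma norm_expI_sub_one_mul_le {K : 𝒜} (hK : IsSelfAdjoint K) (X : 𝒜) (t : ℝ) :
    ‖expI K t * X - X‖ ≤ ‖K * X‖ * |t| := by
  have h1 := norm_sub_le_of_hasDerivAt (C := ‖K * X‖) (t := t)
    (fun s => (hasDerivAt_expI K s).mul_const X) (fun s _ => by
      rw [mul_assoc, CStarRing.norm_mem_unitary_mul _ (expI_mem_unitary hK _), smul_mul_assoc,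
        norm_smul]; simp)
  simpa using h1

/-- The comparison of two evolutions `e^{itH} e^{-itK}` is generated by `τ_t(H - K)`, so it
almost commutes with whatever those operators almost commute with. -/
lemma norm_lie_expI_mul_expI_le {H K W : 𝒜} (hH : IsSelfAdjoint H) (hK : IsSelfAdjoint K)
    {C t : ℝ} (hC : ∀ s, |s| ≤ |t| → ‖⁅heis H s (H - K), W⁆‖ ≤ C) :
    ‖⁅expI H t * expI K (-t), W⁆‖ ≤ C * |t| := by
  have h1 := norm_sub_le_of_hasDerivAt (C := C) (t := t) (hasDerivAt_heis_heis H K W)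
    (fun s hs => by
      rw [norm_heis hK, norm_neg, norm_smul, Complex.norm_I, one_mul, ← norm_lie_heis hH]
      exact hC s hs)
  refine le_trans (le_of_eq ?_) h1
  simp only [neg_zero, heis_zero]
  set U := expI H t * expI K (-t)
  have hU : U ∈ unitary 𝒜 := mul_mem (expI_mem_unitary hH _) (expI_mem_unitary hK _)
  have h2 : ⁅U, W⁆ = -(U * (heis K t (heis H (-t) W) - W)) := by
    have : U * heis K t (heis H (-t) W) = W * U := by
      simp only [U, heis, neg_neg]
      calc expI H t * expI K (-t) * (expI K t * (expI H (-t) * W * expI H t) * expI K (-t))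
          = expI H t * (expI K (-t) * expI K t) * expI H (-t) * W * expI H t * expI K (-t) := by
            simp only [mul_assoc]
        _ = _ := by simp [mul_assoc]
    rw [mul_sub, this, Ring.lie_def]; abel
  rw [h2, norm_neg, CStarRing.norm_mem_unitary_mul _ hU]

/-- The time average `∫ τ_t(a) dν(t)`. -/
noncomputable def timeAverage (ν : Measure ℝ) (H a : 𝒜) : 𝒜 := ∫ t, heis H t a ∂ν

lemma integrable_heis {H : 𝒜} (hH : IsSelfAdjoint H) (ν : Measure ℝ) [IsProbabilityMeasure ν]
    (a : 𝒜) : Integrable (fun t => heis H t a) ν :=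
  integrable_of_continuous_of_bound (continuous_heis H a) (fun t => (norm_heis hH t a).le) ν

lemma timeAverage_self (H : 𝒜) (ν : Measure ℝ) [IsProbabilityMeasure ν] :
    timeAverage ν H H = H := by
  simp [timeAverage, heis_self]

lemma timeAverage_add {H : 𝒜} (hH : IsSelfAdjoint H) (ν : Measure ℝ) [IsProbabilityMeasure ν]
    (a b : 𝒜) :
    timeAverage ν H (a + b) = timeAverage ν H a + timeAverage ν H b := by
  simp only [timeAverage, heis_add_right]
  exact integral_add (integrable_heis hH ν a) (integrable_heis hH ν b)

lemma isSelfAdjoint_timeAverage {H : 𝒜} (hH : IsSelfAdjoint H) (ν : Measure ℝ)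
    {a : 𝒜} (ha : IsSelfAdjoint a) :
    IsSelfAdjoint (timeAverage ν H a) := by
  rw [isSelfAdjoint_iff, timeAverage]
  have h := (starL' ℝ : 𝒜 ≃L[ℝ] 𝒜).integral_comp_comm (μ := ν) (fun t => heis H t a)
  simp only [starL'_apply] at h
  rw [← h]
  simp only [star_heis hH, ha.star_eq]

lemma norm_lie_timeAverage_le {H : 𝒜} (hH : IsSelfAdjoint H) (ν : Measure ℝ)
    [IsProbabilityMeasure ν] {a W : 𝒜} {T δ : ℝ} (hT : ∀ᵐ t ∂ν, |t| ≤ T)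
    (h : ∀ t, |t| ≤ T → ‖⁅heis H t a, W⁆‖ ≤ δ) : ‖⁅timeAverage ν H a, W⁆‖ ≤ δ := by
  rw [timeAverage, lie_integral_left (integrable_heis hH ν a)]
  refine norm_integral_le_of_ae_le ?_
  filter_upwards [hT] with t ht using h t ht

lemma heis_timeAverage {H : 𝒜} (hH : IsSelfAdjoint H) (ν : Measure ℝ) [IsProbabilityMeasure ν]
    (s : ℝ) (a : 𝒜) :
    heis H s (timeAverage ν H a) = ∫ t, heis H (s + t) a ∂ν := by
  rw [timeAverage, heis, ← integral_const_mul_of_integrable (integrable_heis hH ν a),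
    ← integral_mul_const_of_integrable ((integrable_heis hH ν a).const_mul _)]
  simp only [← heis_heis]; rfl

/-- Time averaging makes an observable without ground state expectation nearly annihilate the
ground state; the error involves only the commutator with `H`. -/
lemma norm_timeAverage_mul_le {H : 𝒜} (hH : IsSelfAdjoint H) (ν : Measure ℝ)
    [IsProbabilityMeasure ν] {P R a : 𝒜} (hP : IsStarProjection P) (hHP : H * P = 0)
    {γ η N : ℝ} (hη : 0 ≤ η) (hγ : 0 < γ)
    (hR : R * H = 1 - P) (hRn : ‖R‖ ≤ 1 / γ) (hν : ‖∫ t, expI H t ∂ν - P‖ ≤ η)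
    (ha : P * a * P = 0) (hN : ‖⁅H, a⁆‖ ≤ N) : ‖timeAverage ν H a * P‖ ≤ η * N / γ := by
  have hPn : ‖P‖ ≤ 1 := hP.norm_le
  have hint : Integrable (expI H) ν := integrable_of_continuous_of_bound (continuous_expI H)
    (fun t => norm_le_one_of_mem_unitary (expI_mem_unitary hH t)) ν
  have h1 : timeAverage ν H a * P = (∫ t, expI H t ∂ν - P) * (a * P) := by
    rw [sub_mul, ← mul_assoc P, ha, sub_zero, timeAverage,
      ← integral_mul_const_of_integrable (integrable_heis hH ν a),
      ← integral_mul_const_of_integrable hint]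
    simp only [heis, mul_assoc, expI_mul_of_mul_eq_zero hHP]
  have h2 : a * P = R * (⁅H, a⁆ * P) := by
    have : ⁅H, a⁆ * P = H * (a * P) := by
      rw [Ring.lie_def, sub_mul, mul_assoc, mul_assoc, hHP, mul_zero, sub_zero]
    rw [this, ← mul_assoc R, hR, sub_mul, one_mul, ← mul_assoc P, ha, sub_zero]
  have hN0 : 0 ≤ N := (norm_nonneg _).trans hN
  have h3 : ‖a * P‖ ≤ N / γ := by
    rw [h2]
    calc ‖R * (⁅H, a⁆ * P)‖ ≤ ‖R‖ * (‖⁅H, a⁆‖ * ‖P‖) :=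
          (norm_mul_le _ _).trans (by gcongr; exact norm_mul_le _ _)
      _ ≤ 1 / γ * (N * 1) := by gcongr
      _ = N / γ := by ring
  rw [h1, mul_div_assoc]
  exact (norm_mul_le _ _).trans (by gcongr)

lemma integrable_expI_mul_expI {H K : 𝒜} (hH : IsSelfAdjoint H) (hK : IsSelfAdjoint K)
    (ν : Measure ℝ) [IsProbabilityMeasure ν] :
    Integrable (fun t => expI H t * expI K (-t)) ν :=
  integrable_of_continuous_of_bound
    ((continuous_expI H).mul ((continuous_expI K).comp continuous_neg))
    (fun t => norm_le_one_of_mem_unitary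
      (mul_mem (expI_mem_unitary hH t) (expI_mem_unitary hK _))) ν

lemma norm_integral_expI_mul_expI_le {H K : 𝒜} (hH : IsSelfAdjoint H) (hK : IsSelfAdjoint K)
    (ν : Measure ℝ) [IsProbabilityMeasure ν] : ‖∫ t, expI H t * expI K (-t) ∂ν‖ ≤ 1 :=
  norm_integral_le_of_ae_le (.of_forall fun t => norm_le_one_of_mem_unitary
    (mul_mem (expI_mem_unitary hH t) (expI_mem_unitary hK _)))

/-- The averaged comparison of the evolutions of `H` and of its averaged interior and exterior
parts almost commutes with what is far from the boundary part `HB`. -/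
lemma norm_lie_integral_expI_mul_expI_le {H HI HE HB W : 𝒜} (hH : IsSelfAdjoint H)
    (hHI : IsSelfAdjoint HI) (hHE : IsSelfAdjoint HE) (hsum : H = HI + HE + HB)
    (ν₁ ν₂ : Measure ℝ) [IsProbabilityMeasure ν₁] [IsProbabilityMeasure ν₂] {T₁ T₂ δ : ℝ}
    (hT₁ : ∀ᵐ t ∂ν₁, |t| ≤ T₁) (hT₂ : ∀ᵐ t ∂ν₂, |t| ≤ T₂)
    (h : ∀ s, |s| ≤ T₁ + T₂ → ‖⁅heis H s HB, W⁆‖ ≤ δ) :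
    ‖⁅∫ t, expI H t * expI (timeAverage ν₁ H HI + timeAverage ν₁ H HE) (-t) ∂ν₂, W⁆‖
      ≤ δ * T₂ := by
  have hK : IsSelfAdjoint (timeAverage ν₁ H HI + timeAverage ν₁ H HE) :=
    (isSelfAdjoint_timeAverage hH ν₁ hHI).add (isSelfAdjoint_timeAverage hH ν₁ hHE)
  have hB : H - (timeAverage ν₁ H HI + timeAverage ν₁ H HE) = timeAverage ν₁ H HB := by
    have h1 := timeAverage_self H ν₁
    nth_rw 2 [hsum] at h1
    rw [timeAverage_add hH, timeAverage_add hH] at h1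
    nth_rw 1 [← h1]; abel
  obtain ⟨t₁, ht₁⟩ := hT₁.exists
  have hδ : 0 ≤ δ := by
    obtain ⟨t₂, ht₂⟩ := hT₂.exists
    refine (norm_nonneg _).trans (h 0 ?_)
    rw [abs_zero]; linarith [abs_nonneg t₁, abs_nonneg t₂]
  rw [lie_integral_left (integrable_expI_mul_expI hH hK ν₂)]
  refine norm_integral_le_of_ae_le ?_
  filter_upwards [hT₂] with t ht
  refine (norm_lie_expI_mul_expI_le hH hK (C := δ) fun s hs => ?_).trans (by gcongr)
  have hint : Integrable (fun t => heis H (s + t) HB) ν₁ :=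
    integrable_of_continuous_of_bound
      ((continuous_heis H HB).comp (continuous_const.add continuous_id))
      (fun t => (norm_heis hH _ HB).le) ν₁
  rw [hB, heis_timeAverage hH, lie_integral_left hint]
  refine norm_integral_le_of_ae_le ?_
  filter_upwards [hT₁] with r hr
  exact h _ ((abs_add_le _ _).trans (by linarith))

/-- The analytic core. `Q = ∫ e^{itH} e^{-itK} dν₂`, with `K` the sum of the time averages of the
interior and exterior Hamiltonians, approximates `P` on the range of `PA * PE`. -/
theorem norm_mul_spectralProj_sub_le {H HI HE P R MI ME Q : 𝒜}
    (hH : IsSelfAdjoint H) (hHI : IsSelfAdjoint HI) (hHE : IsSelfAdjoint HE)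
    (hP : IsStarProjection P) (hHP : H * P = 0) {γ N η₁ η₂ T₂ δ κ a : ℝ}
    (hγ : 0 < γ) (ha : 0 < a) (hη₁ : 0 ≤ η₁) (hR : R * H = 1 - P) (hRn : ‖R‖ ≤ 1 / γ)
    (ν₁ ν₂ : Measure ℝ) [IsProbabilityMeasure ν₁] [IsProbabilityMeasure ν₂]
    (hν₁ : ‖∫ t, expI H t ∂ν₁ - P‖ ≤ η₁) (hν₂ : ‖∫ t, expI H t ∂ν₂ - P‖ ≤ η₂)
    (hT₂ : ∀ᵐ t ∂ν₂, |t| ≤ T₂)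
    (hI0 : P * HI * P = 0) (hE0 : P * HE * P = 0)
    (hIN : ‖⁅H, HI⁆‖ ≤ N) (hEN : ‖⁅H, HE⁆‖ ≤ N)
    (hMI : IsSelfAdjoint MI) (hME : IsSelfAdjoint ME)
    (hfin : ∀ b : 𝒜, (spectrum ℂ b).Finite)
    (hMIδ : ‖MI - timeAverage ν₁ H HI‖ ≤ δ) (hMEδ : ‖ME - timeAverage ν₁ H HE‖ ≤ δ)
    (hcomm : Commute (spectralProj a MI) (spectralProj a ME))
    (hQ : ‖Q - ∫ t, expI H t *
      expI (timeAverage ν₁ H HI + timeAverage ν₁ H HE) (-t) ∂ν₂‖ ≤ κ) :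
    ‖Q * spectralProj a MI * spectralProj a ME - P‖
      ≤ κ + 2 * (a + δ) * T₂ + η₂ + 2 * (δ + η₁ * N / γ) / a := by
  have hnI : IsStarNormal MI := hMI.isStarNormal
  have hnE : IsStarNormal ME := hME.isStarNormal
  set A := timeAverage ν₁ H HI with hA
  set E := timeAverage ν₁ H HE with hE
  set K := A + E
  have hAs : IsSelfAdjoint A := isSelfAdjoint_timeAverage hH ν₁ hHI
  have hEs : IsSelfAdjoint E := isSelfAdjoint_timeAverage hH ν₁ hHE
  have hK : IsSelfAdjoint K := hAs.add hEs
  set p := spectralProj a MI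
  set r := spectralProj a ME
  have hp : IsStarProjection p := isStarProjection_cfc (hfin _) _
  have hr : IsStarProjection r := isStarProjection_cfc (hfin _) _
  have hp1 : ‖p‖ ≤ 1 := hp.norm_le
  have hr1 : ‖r‖ ≤ 1 := hr.norm_le
  have hP1 : ‖P‖ ≤ 1 := hP.norm_le
  have hpr1 : ‖p * r‖ ≤ 1 := (norm_mul_le _ _).trans (mul_le_one₀ hp1 (norm_nonneg _) hr1)
  have hδ : 0 ≤ δ := (norm_nonneg _).trans hMIδ
  have hT0 : 0 ≤ T₂ := by
    obtain ⟨t, ht⟩ := hT₂.exists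
    exact (abs_nonneg t).trans ht
  have key : ∀ {M B : 𝒜}, IsSelfAdjoint M → ‖M - B‖ ≤ δ → ‖B * spectralProj a M‖ ≤ a + δ :=
    fun {M B} hM hB => by
      have : IsStarNormal M := hM.isStarNormal
      have h1 : ‖spectralProj a M‖ ≤ 1 :=
        (isStarProjection_cfc (hfin M) fun z : ℂ => ‖z‖ ≤ a).norm_le
      have h2 : B * spectralProj a M = M * spectralProj a M - (M - B) * spectralProj a M := by
        rw [sub_mul]; abel
      rw [h2]
      refine (norm_sub_le _ _).trans (add_le_add (norm_mul_spectralProj_le hM (hfin M) ha.le) ?_)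
      exact (norm_mul_le _ _).trans (by nlinarith [norm_nonneg (M - B)])
  have hKX : ‖K * (p * r)‖ ≤ 2 * (a + δ) := by
    have h1 : K * (p * r) = A * p * r + E * r * p := by
      rw [add_mul]; nth_rw 2 [hcomm.eq]; simp only [mul_assoc]
    rw [h1]
    have h2 : ‖A * p * r‖ ≤ (a + δ) * 1 :=
      (norm_mul_le _ _).trans (mul_le_mul (key hMI hMIδ) hr1 (norm_nonneg _) (by positivity))
    have h3 : ‖E * r * p‖ ≤ (a + δ) * 1 :=
      (norm_mul_le _ _).trans (mul_le_mul (key hME hMEδ) hp1 (norm_nonneg _) (by positivity))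
    exact (norm_add_le _ _).trans (by linarith)
  have hint : Integrable (expI H) ν₂ := integrable_of_continuous_of_bound (continuous_expI H)
    (fun t => norm_le_one_of_mem_unitary (expI_mem_unitary hH t)) ν₂
  have hintU := integrable_expI_mul_expI hH hK ν₂
  set Uν := ∫ t, expI H t * expI K (-t) ∂ν₂
  set Pν := ∫ t, expI H t ∂ν₂
  have h1 : ‖(Q - Uν) * (p * r)‖ ≤ κ :=
    (norm_mul_le _ _).trans (by nlinarith [norm_nonneg (Q - Uν)])
  have h2 : ‖(Uν - Pν) * (p * r)‖ ≤ 2 * (a + δ) * T₂ := by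
    rw [← integral_sub hintU hint, ← integral_mul_const_of_integrable (by exact hintU.sub hint)]
    refine norm_integral_le_of_ae_le ?_
    filter_upwards [hT₂] with t ht
    have h3 : (expI H t * expI K (-t) - expI H t) * (p * r)
        = expI H t * (expI K (-t) * (p * r) - p * r) := by
      rw [sub_mul, mul_sub, mul_assoc]
    rw [h3, CStarRing.norm_mem_unitary_mul _ (expI_mem_unitary hH t)]
    refine (norm_expI_sub_one_mul_le hK _ _).trans ?_
    rw [abs_neg]; gcongr
  have h3 : ‖(Pν - P) * (p * r)‖ ≤ η₂ :=
    (norm_mul_le _ _).trans (by nlinarith [norm_nonneg (Pν - P)])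
  have cheb : ∀ {M B : 𝒜}, IsSelfAdjoint M → ‖M - B‖ ≤ δ → ‖B * P‖ ≤ η₁ * N / γ →
      ‖P * (1 - spectralProj a M)‖ ≤ (δ + η₁ * N / γ) / a := fun {M B} hM hB hBP => by
    have : IsStarNormal M := hM.isStarNormal
    have hs : IsStarProjection (spectralProj a M) := isStarProjection_cfc (hfin M) _
    rw [← norm_star, star_mul, hP.isSelfAdjoint.star_eq, hs.one_sub.isSelfAdjoint.star_eq]
    refine (norm_one_sub_spectralProj_mul_le hM (hfin M) ha P).trans ?_
    have h2 : M * P = (M - B) * P + B * P := by rw [sub_mul]; abel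
    gcongr
    rw [h2]
    refine (norm_add_le _ _).trans (add_le_add ?_ hBP)
    exact (norm_mul_le _ _).trans (by nlinarith [norm_nonneg (M - B)])
  have h4 : ‖P * (p * r) - P‖ ≤ 2 * (δ + η₁ * N / γ) / a := by
    have hcI := cheb hMI hMIδ
      (norm_timeAverage_mul_le hH ν₁ hP hHP hη₁ hγ hR hRn hν₁ hI0 hIN)
    have hcE := cheb hME hMEδ
      (norm_timeAverage_mul_le hH ν₁ hP hHP hη₁ hγ hR hRn hν₁ hE0 hEN)
    have h5 : P * (p * r) - P = -(P * (1 - p) + P * (1 - r) * p) := by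
      rw [hcomm.eq]; noncomm_ring
    rw [h5, norm_neg]
    refine (norm_add_le _ _).trans ?_
    have h6 : ‖P * (1 - r) * p‖ ≤ (δ + η₁ * N / γ) / a :=
      (norm_mul_le _ _).trans (by nlinarith [norm_nonneg (P * (1 - r))])
    calc _ ≤ _ := add_le_add hcI h6
      _ = _ := by ring
  have h5 : Q * p * r - P
      = (Q - Uν) * (p * r) + (Uν - Pν) * (p * r) + (Pν - P) * (p * r) + (P * (p * r) - P) := by
    noncomm_ring
  rw [h5]
  refine (norm_add_le _ _).trans (add_le_add ((norm_add_le _ _).trans (add_le_add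
    ((norm_add_le _ _).trans (add_le_add h1 h2)) h3)) h4)

end Core

/-! ### Local algebras -/

section LocalAlgebra

open Complex

variable {d : ℕ} {V : Finset (Fin d → ℤ)} {n : V → ℕ}

lemma localEmbed_apply (X : Finset V)
    (a : Matrix ((x : {x : V // x ∈ X}) → Fin (n x)) ((x : {x : V // x ∈ X}) → Fin (n x)) ℂ)
    (σ τ : Config n) :
    localEmbed n X a σ τ = a (fun x => σ x) (fun x => τ x) *
      if (∀ x ∉ X, σ x = τ x) then 1 else 0 := by
  simp only [localEmbed, Matrix.submatrix_apply, Matrix.kroneckerMap_apply, Matrix.one_apply,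
    Equiv.piEquivPiSubtypeProd_apply, funext_iff, Subtype.forall]

/-- Membership in `𝒜_X` in terms of matrix entries: an entry vanishes unless the two
configurations agree off `X`, and it depends only on their restrictions to `X`. -/
lemma mem_localAlgebra_iff {X : Finset V} {M : Observable n} :
    M ∈ localAlgebra n X ↔ (∀ σ τ : Config n, (∃ x ∉ X, σ x ≠ τ x) → M σ τ = 0) ∧
      ∀ σ τ σ' τ' : Config n, (∀ x ∈ X, σ x = σ' x) → (∀ x ∈ X, τ x = τ' x) →
        (∀ x ∉ X, σ x = τ x) → (∀ x ∉ X, σ' x = τ' x) → M σ τ = M σ' τ' := by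
  constructor
  · rintro ⟨a, rfl⟩
    refine ⟨fun σ τ ⟨x, hx, hne⟩ => ?_, fun σ τ σ' τ' h1 h2 h3 h4 => ?_⟩
    · rw [localEmbed_apply, if_neg fun h => hne (h x hx), mul_zero]
    · rw [localEmbed_apply, localEmbed_apply, if_pos h3, if_pos h4]
      congr 2
      · ext x; rw [h1 x x.2]
      · ext x; rw [h2 x x.2]
  · rintro ⟨h1, h2⟩
    rcases isEmpty_or_nonempty (Config n) with he | ⟨⟨ρ⟩⟩
    · exact ⟨0, by ext σ; exact he.elim σ⟩
    · classical
      let ext' : ((x : {x : V // x ∈ X}) → Fin (n x)) → Config n :=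
        fun s x => if hx : x ∈ X then s ⟨x, hx⟩ else ρ x
      refine ⟨Matrix.of fun s t => M (ext' s) (ext' t), ?_⟩
      ext σ τ
      rw [localEmbed_apply]
      split_ifs with h
      · rw [mul_one, Matrix.of_apply]
        refine h2 _ _ _ _ ?_ ?_ ?_ h <;> intro x hx <;> simp [ext', hx]
      · rw [mul_zero, h1 σ τ (by push Not at h; exact h)]

lemma localAlgebra_mono {X Y : Finset V} (h : X ⊆ Y) : localAlgebra n X ⊆ localAlgebra n Y := by
  intro M hM
  rw [mem_localAlgebra_iff] at hM ⊢
  refine ⟨fun σ τ ⟨x, hx, hne⟩ => hM.1 σ τ ⟨x, fun hx' => hx (h hx'), hne⟩,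
    fun σ τ σ' τ' h1 h2 h3 h4 => ?_⟩
  by_cases hd : ∃ x ∉ X, σ x ≠ τ x
  · obtain ⟨x, hx, hne⟩ := hd
    have hxY : x ∈ Y := by
      by_contra hxY; exact hne (h3 x hxY)
    rw [hM.1 σ τ ⟨x, hx, hne⟩, hM.1 σ' τ' ⟨x, hx, by rwa [← h1 x hxY, ← h2 x hxY]⟩]
  · push Not at hd
    refine hM.2 _ _ _ _ (fun x hx => h1 x (h hx)) (fun x hx => h2 x (h hx)) hd fun x hx => ?_
    by_cases hxY : x ∈ Y
    · rw [← h1 x hxY, ← h2 x hxY, hd x hx]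
    · exact h4 x hxY

lemma commute_of_mem_localAlgebra_compl {X : Finset V} {M N : Observable n}
    (hM : M ∈ localAlgebra n X) (hN : N ∈ localAlgebra n Xᶜ) : Commute M N := by
  classical
  rw [mem_localAlgebra_iff] at hM hN
  simp only [Finset.mem_compl, not_not] at hN
  ext σ τ
  let ρ : Config n := fun x => if x ∈ X then τ x else σ x
  let ρ' : Config n := fun x => if x ∈ X then σ x else τ x
  rw [Matrix.mul_apply, Matrix.mul_apply, Finset.sum_eq_single ρ, Finset.sum_eq_single ρ']
  · rw [mul_comm, hM.2 σ ρ ρ' τ, hN.2 ρ τ σ ρ'] <;> intro x hx <;> simp [ρ, ρ', hx]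
  · intro κ _ hκ
    obtain ⟨x, hx⟩ := Function.ne_iff.1 hκ
    by_cases hxX : x ∈ X
    · rw [hN.1 σ κ ⟨x, hxX, fun h => hx (by simp [ρ', hxX, h])⟩, zero_mul]
    · rw [hM.1 κ τ ⟨x, hxX, fun h => hx (by simp [ρ', hxX, h])⟩, mul_zero]
  · simp
  · intro κ _ hκ
    obtain ⟨x, hx⟩ := Function.ne_iff.1 hκ
    by_cases hxX : x ∈ X
    · rw [hN.1 κ τ ⟨x, hxX, fun h => hx (by simp [ρ, hxX, h])⟩, mul_zero]
    · rw [hM.1 σ κ ⟨x, hxX, fun h => hx (by simp [ρ, hxX, h])⟩, zero_mul]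
  · simp

lemma commute_of_disjoint {X Y : Finset V} (h : Disjoint X Y) {M N : Observable n}
    (hM : M ∈ localAlgebra n X) (hN : N ∈ localAlgebra n Y) : Commute M N :=
  commute_of_mem_localAlgebra_compl hM
    (localAlgebra_mono (fun _ hy => Finset.mem_compl.2 fun hx =>
      (Finset.disjoint_left.1 h) hx hy) hN)

/-- The embedding `a ↦ a ⊗ 1` as a homomorphism of star algebras. -/
noncomputable def localEmbedHom (n : V → ℕ) (X : Finset V) :
    Matrix ((x : {x : V // x ∈ X}) → Fin (n x)) ((x : {x : V // x ∈ X}) → Fin (n x)) ℂ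
      →⋆ₐ[ℂ] Observable n where
  toFun := localEmbed n X
  map_one' := by simp [localEmbed]
  map_mul' a b := by
    rw [localEmbed, localEmbed, localEmbed, Matrix.submatrix_mul_equiv, ← Matrix.mul_kronecker_mul,
      mul_one]
  map_zero' := by simp [localEmbed]
  map_add' a b := by rw [localEmbed, Matrix.add_kronecker]; rfl
  commutes' c := by
    rw [Algebra.algebraMap_eq_smul_one, Algebra.algebraMap_eq_smul_one, localEmbed,
      Matrix.smul_kronecker, Matrix.one_kronecker_one, Matrix.submatrix_smul]
    simp
  map_star' a := by
    simp [localEmbed, Matrix.star_eq_conjTranspose, Matrix.conjTranspose_kronecker]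

lemma one_mem_localAlgebra (X : Finset V) : (1 : Observable n) ∈ localAlgebra n X :=
  one_mem (localEmbedHom n X).range

lemma smul_mem_localAlgebra {X : Finset V} (c : ℂ) {M : Observable n}
    (h : M ∈ localAlgebra n X) : c • M ∈ localAlgebra n X :=
  (localEmbedHom n X).range.smul_mem h c

lemma sum_mem_localAlgebra {κ : Type*} {X : Finset V} {s : Finset κ} {f : κ → Observable n}
    (h : ∀ k ∈ s, f k ∈ localAlgebra n X) : ∑ k ∈ s, f k ∈ localAlgebra n X :=
  sum_mem (S := (localEmbedHom n X).range) h

lemma add_mem_localAlgebra {X : Finset V} {M N : Observable n}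
    (hM : M ∈ localAlgebra n X) (hN : N ∈ localAlgebra n X) : M + N ∈ localAlgebra n X :=
  (localEmbedHom n X).range.add_mem hM hN

lemma finite_spectrum {ι : Type*} [Fintype ι] [DecidableEq ι] (M : Matrix ι ι ℂ) :
    (spectrum ℂ M).Finite := by
  rw [← Matrix.spectrum_toLin']
  exact Module.End.finite_spectrum _

lemma localEmbed_injective [Nonempty (Config n)] (X : Finset V) :
    Function.Injective (localEmbed n X) := by
  classical
  intro a b h
  obtain ⟨ρ⟩ := ‹Nonempty (Config n)›
  ext s t
  let ext' : ((x : {x : V // x ∈ X}) → Fin (n x)) → Config n :=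
    fun s x => if hx : x ∈ X then s ⟨x, hx⟩ else ρ x
  have h1 := congrFun (congrFun h (ext' s)) (ext' t)
  rw [localEmbed_apply, localEmbed_apply, if_pos (by intro x hx; simp [ext', hx])] at h1
  simpa [ext'] using h1

/-- Local algebras are closed under functional calculus. -/
lemma cfc_mem_localAlgebra [Nonempty (Config n)] {X : Finset V} {M : Observable n}
    (hM : M ∈ localAlgebra n X) (hsa : IsSelfAdjoint M) (f : ℂ → ℂ) :
    cfc f M ∈ localAlgebra n X := by
  obtain ⟨m, rfl⟩ := hM
  have hm : IsSelfAdjoint m := by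
    rw [isSelfAdjoint_iff]
    apply localEmbed_injective (n := n) X
    calc localEmbed n X (star m) = star (localEmbed n X m) := map_star (localEmbedHom n X) m
      _ = _ := hsa.star_eq
  refine ⟨cfc f m, ?_⟩
  have hc : Continuous (localEmbedHom n X) :=
    (localEmbedHom n X).toAlgHom.toLinearMap.continuous_of_finiteDimensional
  exact (localEmbedHom n X).map_cfc (S := ℂ) f m
    ((finite_spectrum m).continuousOn _) hc hm.isStarNormal hsa.isStarNormal

end LocalAlgebra

/-! ### Localization of observables with small commutators -/

section Localization

open Complex

variable {d : ℕ} {V : Finset (Fin d → ℤ)} {n : V → ℕ}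

/-- Configurations of the complement of `X`. -/
abbrev OffConfig (n : V → ℕ) (X : Finset V) : Type := (x : {x : V // x ∉ X}) → Fin (n x)

/-- A permutation of the configurations off `X` together with a choice of signs. -/
abbrev SignedPerm (n : V → ℕ) (X : Finset V) : Type :=
  Equiv.Perm (OffConfig n X) × (OffConfig n X → ℤˣ)

/-- The permutation of the configurations that acts on the part off `X` only. -/
def permOff (X : Finset V) (π : Equiv.Perm (OffConfig n X)) :
    Equiv.Perm (Config n) :=
  (Equiv.piEquivPiSubtypeProd (fun x : V => x ∈ X) fun x => Fin (n x)).trans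
    ((Equiv.prodCongr (Equiv.refl _) π).trans
      (Equiv.piEquivPiSubtypeProd (fun x : V => x ∈ X) fun x => Fin (n x)).symm)

lemma permOff_apply_mem (X : Finset V) (π : Equiv.Perm (OffConfig n X))
    (σ : Config n) {x : V} (hx : x ∈ X) : permOff X π σ x = σ x := by
  simp [permOff, Equiv.piEquivPiSubtypeProd, hx]

lemma restrict_permOff (X : Finset V) (π : Equiv.Perm (OffConfig n X))
    (σ : Config n) :
    (fun x : {x : V // x ∉ X} => permOff X π σ x) = π fun x => σ x := by
  ext ⟨x, hx⟩
  simp [permOff, Equiv.piEquivPiSubtypeProd, hx]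

/-- A signed permutation of the basis labels off `X`, as an operator on the whole system. -/
def signedPerm (X : Finset V) (π : Equiv.Perm (OffConfig n X))
    (s : OffConfig n X → ℤˣ) : Observable n :=
  Matrix.of fun σ τ => if τ = permOff X π σ then (((s fun x => τ x : ℤˣ) : ℤ) : ℂ) else 0

lemma signedPerm_conj_apply (X : Finset V)
    (π : Equiv.Perm (OffConfig n X))
    (s : OffConfig n X → ℤˣ) (K : Observable n) (σ τ : Config n) :
    (signedPerm X π s * K * star (signedPerm X π s)) σ τ =
      (((s (π fun x => σ x) * s (π fun x => τ x) : ℤˣ) : ℤ) : ℂ) *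
        K (permOff X π σ) (permOff X π τ) := by
  rw [Matrix.mul_apply, Finset.sum_eq_single (permOff X π τ), Matrix.mul_apply,
    Finset.sum_eq_single (permOff X π σ)]
  · simp only [signedPerm, Matrix.of_apply, if_true, Matrix.star_apply, restrict_permOff,
      RCLike.star_def, map_intCast, Units.val_mul, Int.cast_mul]
    ring
  · intro ρ _ hρ
    simp [signedPerm, hρ]
  · simp
  · intro ρ _ hρ
    simp [signedPerm, Matrix.star_apply, hρ]
  · simp

lemma signedPerm_mem_unitary (X : Finset V)
    (π : Equiv.Perm (OffConfig n X))
    (s : OffConfig n X → ℤˣ) :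
    signedPerm X π s ∈ unitary (Observable n) := by
  have h : signedPerm X π s * star (signedPerm X π s) = 1 := by
    ext σ τ
    have h1 := signedPerm_conj_apply X π s 1 σ τ
    rw [mul_one] at h1
    rw [h1]
    by_cases hστ : σ = τ
    · subst hστ; simp
    · simp [hστ]
  exact Unitary.mem_iff.2 ⟨mul_eq_one_comm.1 h, h⟩

lemma signedPerm_mem_localAlgebra (X : Finset V)
    (π : Equiv.Perm (OffConfig n X))
    (s : OffConfig n X → ℤˣ) :
    signedPerm X π s ∈ localAlgebra n Xᶜ := by
  have key : ∀ σ τ : Config n, (∀ x ∈ X, σ x = τ x) →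
      (τ = permOff X π σ ↔
        (fun x : {x : V // x ∉ X} => τ x) = π fun x => σ x) := fun σ τ h => by
    rw [← restrict_permOff]
    refine ⟨fun h => by rw [h], fun h' => funext fun x => ?_⟩
    by_cases hx : x ∈ X
    · rw [permOff_apply_mem X π σ hx, h x hx]
    · exact congrFun h' ⟨x, hx⟩
  rw [mem_localAlgebra_iff]
  simp only [Finset.mem_compl, not_not]
  refine ⟨fun σ τ ⟨x, hx, hne⟩ => ?_, fun σ τ σ' τ' h1 h2 h3 h4 => ?_⟩
  · have : τ ≠ permOff X π σ := fun h => hne (by rw [h, permOff_apply_mem X π σ hx])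
    simp [signedPerm, this]
  · have e1 : (fun x : {x : V // x ∉ X} => σ x) = fun x : {x : V // x ∉ X} => σ' x :=
      funext fun x => h1 x x.2
    have e2 : (fun x : {x : V // x ∉ X} => τ x) = fun x : {x : V // x ∉ X} => τ' x :=
      funext fun x => h2 x x.2
    simp only [signedPerm, Matrix.of_apply, key σ τ h3, key σ' τ' h4, e1, e2]

lemma sum_sign_mul_sign_eq_zero {β : Type*} [Fintype β] [DecidableEq β] {b c : β} (h : b ≠ c) :
    ∑ s : β → ℤˣ, (((s b * s c : ℤˣ) : ℤ) : ℂ) = 0 := by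
  have h1 := Equiv.sum_comp (Equiv.mulRight (Pi.mulSingle b (-1) : β → ℤˣ))
    fun s : β → ℤˣ => (((s b * s c : ℤˣ) : ℤ) : ℂ)
  have h2 : ∀ s : β → ℤˣ,
      ((((Equiv.mulRight (Pi.mulSingle b (-1) : β → ℤˣ)) s b *
        (Equiv.mulRight (Pi.mulSingle b (-1) : β → ℤˣ)) s c : ℤˣ) : ℤ) : ℂ)
        = -(((s b * s c : ℤˣ) : ℤ) : ℂ) := fun s => by
    simp [Pi.mulSingle_eq_of_ne h.symm]
  simp only [h2, Finset.sum_neg_distrib] at h1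
  exact self_eq_neg.1 h1.symm

lemma sum_perm_apply_eq {β E : Type*} [Fintype β] [DecidableEq β] [AddCommMonoid E] (f : β → E)
    (b c : β) : ∑ π : Equiv.Perm β, f (π b) = ∑ π : Equiv.Perm β, f (π c) := by
  have h := Equiv.sum_comp (Equiv.mulRight (Equiv.swap b c)) fun π : Equiv.Perm β => f (π b)
  rw [← h]; simp

/-- The configuration with restrictions `a` to `X` and `b` to the complement of `X`. -/
def glue (X : Finset V) (a : (x : {x : V // x ∈ X}) → Fin (n x)) (b : OffConfig n X) : Config n :=
  (Equiv.piEquivPiSubtypeProd (fun x : V => x ∈ X) fun x => Fin (n x)).symm (a, b)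

/-- Summing over the signs kills the entries that are not diagonal off `X`, and summing over the
permutations makes the diagonal ones independent of the configuration off `X`. -/
lemma sum_signedPerm_conj_apply (X : Finset V) [DecidableEq (OffConfig n X)] (K : Observable n)
    (b : OffConfig n X) (σ τ : Config n) :
    ∑ g : SignedPerm n X,
        (signedPerm X g.1 g.2 * K * star (signedPerm X g.1 g.2)) σ τ =
      (∑ _s : OffConfig n X → ℤˣ, ∑ π : Equiv.Perm (OffConfig n X),
        K (glue X (fun x => σ x) (π b)) (glue X (fun x => τ x) (π b))) *
        if (∀ x ∉ X, σ x = τ x) then 1 else 0 := by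
  have hperm : ∀ (π : Equiv.Perm (OffConfig n X)) (σ : Config n),
      permOff X π σ = glue X (fun x => σ x) (π fun x => σ x) := fun π σ => rfl
  simp only [signedPerm_conj_apply]
  split_ifs with h
  · have h' : (fun x : {x : V // x ∉ X} => τ x) = fun x : {x : V // x ∉ X} => σ x :=
      funext fun x => (h x x.2).symm
    rw [mul_one, Fintype.sum_prod_type_right]
    refine Finset.sum_congr rfl fun s _ => ?_
    simp only [hperm, h', Int.units_mul_self, Units.val_one, Int.cast_one, one_mul]
    exact sum_perm_apply_eq
      (fun b => K (glue X (fun x => σ x) b) (glue X (fun x => τ x) b)) _ _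
  · rw [mul_zero, Fintype.sum_prod_type]
    refine Finset.sum_eq_zero fun π _ => ?_
    have hne : (π fun x => σ x) ≠ π fun x => τ x := fun h1 =>
      h fun x hx => congrFun (π.injective h1) ⟨x, hx⟩
    rw [← zero_mul (K (permOff X π σ) (permOff X π τ)), ← sum_sign_mul_sign_eq_zero hne,
      Finset.sum_mul]

/-- An observable that almost commutes with the unitaries of `𝒜_{V ∖ X}` is close to an element of
`𝒜_X`, namely to its average over the group of signed permutations of the basis off `X`. -/
theorem exists_mem_localAlgebra_of_norm_lie_le [Nonempty (Config n)] (X : Finset V)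
    (K : Observable n) {δ : ℝ}
    (hK : ∀ W ∈ unitary (Observable n), W ∈ localAlgebra n Xᶜ → ‖⁅K, W⁆‖ ≤ δ) :
    ∃ M ∈ localAlgebra n X, ‖M‖ ≤ ‖K‖ ∧ ‖M - K‖ ≤ δ ∧ (IsSelfAdjoint K → IsSelfAdjoint M) := by
  have : DecidableEq (OffConfig n X) := Classical.decEq _
  let U : SignedPerm n X → Observable n := fun g => signedPerm X g.1 g.2
  have hU : ∀ g, U g ∈ unitary (Observable n) := fun g =>
    signedPerm_mem_unitary X g.1 g.2
  have hcard : (0 : ℝ) < Fintype.card (SignedPerm n X) := by exact_mod_cast Fintype.card_pos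
  have hcard' : (Fintype.card (SignedPerm n X) : ℂ) ≠ 0 := by exact_mod_cast hcard.ne'
  let M : Observable n := (Fintype.card (SignedPerm n X) : ℂ)⁻¹ • ∑ g, U g * K * star (U g)
  have havg : ∀ {f : SignedPerm n X → Observable n} {C : ℝ}, (∀ g, ‖f g‖ ≤ C) →
      ‖(Fintype.card (SignedPerm n X) : ℂ)⁻¹ • ∑ g, f g‖ ≤ C := fun {f C} hf => by
    rw [norm_smul, norm_inv, Complex.norm_natCast, inv_mul_le_iff₀ hcard]
    refine (norm_sum_le _ _).trans ((Finset.sum_le_sum fun g _ => hf g).trans ?_)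
    simp
  refine ⟨M, ?_, ?_, ?_, ?_⟩
  · obtain ⟨ρ⟩ := ‹Nonempty (Config n)›
    refine ⟨Matrix.of fun a a' => (Fintype.card (SignedPerm n X) : ℂ)⁻¹ *
      ∑ s : OffConfig n X → ℤˣ, ∑ π : Equiv.Perm (OffConfig n X),
        K (glue X a (π fun x => ρ x)) (glue X a' (π fun x => ρ x)), ?_⟩
    ext σ τ
    rw [localEmbed_apply]
    simp only [M, U, Matrix.smul_apply, Matrix.sum_apply, smul_eq_mul, Matrix.of_apply,
      sum_signedPerm_conj_apply X K (fun x => ρ x)]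
    exact mul_assoc _ _ _
  · refine havg fun g => ?_
    rw [CStarRing.norm_mul_mem_unitary _ (Unitary.star_mem (hU g)),
      CStarRing.norm_mem_unitary_mul _ (hU g)]
  · have h1 : M - K = (Fintype.card (SignedPerm n X) : ℂ)⁻¹ • ∑ g, (U g * K * star (U g) - K) := by
      rw [Finset.sum_sub_distrib, smul_sub, Finset.sum_const, Finset.card_univ,
        ← Nat.cast_smul_eq_nsmul ℂ, smul_smul, inv_mul_cancel₀ hcard', one_smul]
    rw [h1]
    refine havg fun g => ?_
    have h2 : U g * K * star (U g) - K = -(⁅K, U g⁆ * star (U g)) := by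
      rw [Ring.lie_def, sub_mul, mul_assoc K, (Unitary.mem_iff.1 (hU g)).2, mul_one]; abel
    rw [h2, norm_neg, CStarRing.norm_mul_mem_unitary _ (Unitary.star_mem (hU g))]
    exact hK _ (hU g) (signedPerm_mem_localAlgebra X _ _)
  · intro hsa
    rw [isSelfAdjoint_iff]
    simp only [M, star_smul, star_sum, star_mul, star_star, hsa.star_eq, mul_assoc]
    congr 1; simp

end Localization

/-! ### The ground state -/

section GroundState

open Complex

variable {ι : Type*} [Fintype ι]

lemma vecMulVec_star_mul_mul (ψ : EuclideanSpace ℂ ι) (M : Matrix ι ι ℂ) :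
    rankOneProj ψ * M * rankOneProj ψ =
      (star (fun i => ψ i) ⬝ᵥ (M.mulVec fun i => ψ i)) • rankOneProj ψ := by
  rw [rankOneProj, mul_assoc, Matrix.mul_vecMulVec, Matrix.vecMulVec_mul_vecMulVec,
    Matrix.vecMulVec_smul]
  rfl

/-- The compression of a self-adjoint operator to a unit vector is a real multiple of the
projection. -/
lemma exists_rankOneProj_mul_mul (ψ : EuclideanSpace ℂ ι) {M : Matrix ι ι ℂ}
    (hM : IsSelfAdjoint M) :
    ∃ c : ℝ, rankOneProj ψ * M * rankOneProj ψ = (c : ℂ) • rankOneProj ψ := by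
  refine ⟨(star (fun i => ψ i) ⬝ᵥ (M.mulVec fun i => ψ i)).re, ?_⟩
  rw [vecMulVec_star_mul_mul]
  congr 1
  have h : Matrix.IsHermitian M := hM
  exact Complex.ext rfl (by simpa using h.im_star_dotProduct_mulVec_self (fun i => ψ i))

variable [DecidableEq ι]

lemma isStarProjection_rankOneProj {ψ : EuclideanSpace ℂ ι} (hψ : ‖ψ‖ = 1) :
    IsStarProjection (rankOneProj ψ) := by
  constructor
  · have h1 := vecMulVec_star_mul_mul ψ 1
    rw [mul_one, Matrix.one_mulVec] at h1
    rw [IsIdempotentElem, h1]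
    have h2 : star (fun i => ψ i) ⬝ᵥ (fun i => ψ i) = 1 := by
      have h3 : inner ℂ ψ ψ = 1 := by rw [inner_self_eq_norm_sq_to_K, hψ]; simp
      rw [← h3, EuclideanSpace.inner_eq_star_dotProduct, dotProduct_comm]
    rw [h2, one_smul]
  · ext i j
    simp [rankOneProj, Matrix.vecMulVec_apply, Matrix.star_apply, mul_comm]

/-- The spectral content of `IsGappedGroundState`, after shifting the ground state energy to
`0`. -/
theorem IsGappedGroundState.exists_energy {H : Matrix ι ι ℂ} {ψ : EuclideanSpace ℂ ι} {γ : ℝ}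
    (hH : IsSelfAdjoint H) (hψ : IsGappedGroundState H ψ γ) :
    ∃ E : ℝ, (∀ x ∈ spectrum ℝ (H - (E : ℂ) • 1), x = 0 ∨ γ ≤ x) ∧
      kerProj (H - (E : ℂ) • 1) = rankOneProj ψ := by
  obtain ⟨hn, E, hE, hgap⟩ := hψ
  have hsp : ∀ x ∈ spectrum ℝ (H - (E : ℂ) • 1), x = 0 ∨ γ ≤ x := fun x hx => by
    have h1 : x + E ∈ spectrum ℝ H := by
      have h2 : H = algebraMap ℝ (Matrix ι ι ℂ) E + (H - (E : ℂ) • 1) := by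
        have : algebraMap ℝ (Matrix ι ι ℂ) E = (E : ℂ) • 1 := by
          rw [Algebra.algebraMap_eq_smul_one]; ext; simp
        rw [this]; abel
      rw [h2]
      exact spectrum.add_mem_add_iff.2 hx
    have h3 : ((x + E : ℝ) : ℂ) ∈ spectrum ℂ H := by
      simpa using (spectrum.algebraMap_mem_iff ℂ (R := ℝ) (a := H) (r := x + E)).2 h1
    rw [← Matrix.spectrum_toLpLin 2, ← Module.End.hasEigenvalue_iff_mem_spectrum] at h3
    by_cases h4 : x + E = E
    · left; linarith
    · right; linarith [hgap _ h3 h4]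
  refine ⟨E, hsp, ?_⟩
  set H' := H - (E : ℂ) • (1 : Matrix ι ι ℂ)
  have hH' : IsSelfAdjoint H' := by
    refine hH.sub ?_
    rw [isSelfAdjoint_iff]; simp
  have hker : ∀ v : EuclideanSpace ℂ ι, H'.mulVec v.ofLp = 0 ↔
      v ∈ Module.End.eigenspace (Matrix.toEuclideanLin H) (E : ℂ) := fun v => by
    rw [Module.End.mem_eigenspace_iff, Matrix.sub_mulVec, Matrix.smul_mulVec, Matrix.one_mulVec,
      sub_eq_zero]
    rw [← (WithLp.equiv 2 _).apply_eq_iff_eq (x := Matrix.toEuclideanLin H v)]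
    rfl
  have hP := isStarProjection_rankOneProj hn
  set P := rankOneProj ψ with hPdef
  have hHP : H' * P = 0 := by
    have h1 : H'.mulVec ψ.ofLp = 0 := by
      rw [hker, hE]; exact Submodule.mem_span_singleton_self ψ
    rw [hPdef, rankOneProj, Matrix.mul_vecMulVec]
    change Matrix.vecMulVec (H'.mulVec ψ.ofLp) _ = 0
    rw [h1]; simp
  have hQ := mul_kerProj hH' (finite_spectrum H')
  obtain ⟨R, hR, -⟩ := exists_resolvent hH' (finite_spectrum H')
  have hn' : IsStarNormal H' := hH'.isStarNormal
  have hQs : IsStarProjection (kerProj H') := isStarProjection_cfc (finite_spectrum H') _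
  set Q := kerProj H'
  have h1 : Q * P = P := by
    have : R * (H' * P) = 0 := by rw [hHP, mul_zero]
    rw [← mul_assoc, hR, sub_mul, one_mul, sub_eq_zero] at this
    exact this.symm
  -- every column of `Q` lies in the ground state eigenspace
  have h2 : P * Q = Q := by
    have hcol : ∀ j, P.mulVec (Q.col j) = Q.col j := fun j => by
      have h3 : H'.mulVec (WithLp.toLp 2 (Q.col j)).ofLp = 0 := by
        change H'.mulVec (Q.col j) = 0
        rw [← Matrix.mulVec_single_one, Matrix.mulVec_mulVec, hQ, Matrix.zero_mulVec]
      rw [hker, hE, Submodule.mem_span_singleton] at h3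
      obtain ⟨c, hc⟩ := h3
      have h4 : Q.col j = c • ψ.ofLp := by
        rw [← WithLp.ofLp_smul, hc]
      have h5 : P.mulVec ψ.ofLp = ψ.ofLp := by
        rw [hPdef, rankOneProj, Matrix.vecMulVec_mulVec]
        have h6 : (fun i => star (ψ i)) ⬝ᵥ ψ.ofLp = 1 := by
          have h3 : inner ℂ ψ ψ = 1 := by rw [inner_self_eq_norm_sq_to_K, hn]; simp
          rw [← h3, EuclideanSpace.inner_eq_star_dotProduct, dotProduct_comm]; rfl
        rw [h6]; simp
      rw [h4, Matrix.mulVec_smul, h5]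
    ext i j
    have := congrFun (hcol j) i
    simpa [Matrix.mul_apply, Matrix.mulVec, dotProduct, Matrix.col] using this
  calc Q = P * Q := h2.symm
    _ = star (Q * P) := by
      rw [star_mul, hQs.isSelfAdjoint.star_eq, hP.isSelfAdjoint.star_eq]
    _ = P := by rw [h1, hP.isSelfAdjoint.star_eq]

end GroundState

/-! ### Vertices and edges of the lattice -/

section Geometry

open Complex

variable {d : ℕ} {V : Finset (Fin d → ℤ)}

lemma latticeDist_self (x : Fin d → ℤ) : latticeDist x x = 0 := by simp [latticeDist]

lemma latticeDist_comm (x y : Fin d → ℤ) : latticeDist x y = latticeDist y x := by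
  simp only [latticeDist]
  exact Finset.sum_congr rfl fun i _ => by omega

lemma latticeDist_triangle (x y z : Fin d → ℤ) :
    latticeDist x z ≤ latticeDist x y + latticeDist y z := by
  simp only [latticeDist, ← Finset.sum_add_distrib]
  exact Finset.sum_le_sum fun i _ => by omega

lemma eq_of_latticeDist_eq_zero {x y : Fin d → ℤ} (h : latticeDist x y = 0) : x = y := by
  funext i
  have := (Finset.sum_eq_zero_iff.1 h) i (Finset.mem_univ i)
  omega

/-- Closed walks in the lattice have even length. -/
lemma two_dvd_latticeDist_add (x y z : Fin d → ℤ) :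
    2 ∣ latticeDist x y + latticeDist y z + latticeDist x z := by
  simp only [latticeDist, ← Finset.sum_add_distrib]
  exact Finset.dvd_sum fun i _ => by omega

lemma latticeDist_le_diam {Z : Finset V} {x y : V} (hx : x ∈ Z) (hy : y ∈ Z) :
    latticeDist x.1 y.1 ≤ diam Z :=
  (Finset.le_sup (f := fun y : V => latticeDist x.1 y.1) hy).trans
    (Finset.le_sup (f := fun x : V => Z.sup fun y => latticeDist x.1 y.1) hx)

/-- As the lattice is bipartite, a set of diameter at most `1` is a vertex or an edge. -/
lemma eq_singleton_or_eq_pair {Z : Finset V} (hZ : diam Z ≤ 1) {x : V} (hx : x ∈ Z) :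
    Z = {x} ∨ ∃ z : V, latticeDist x.1 z.1 = 1 ∧ Z = {x, z} := by
  by_cases h : Z = {x}
  · exact Or.inl h
  right
  have hdist : ∀ {a b : V}, a ∈ Z → b ∈ Z → a ≠ b → latticeDist a.1 b.1 = 1 :=
    fun {a b} ha hb hab => by
      have h1 := (latticeDist_le_diam ha hb).trans hZ
      have h2 : latticeDist a.1 b.1 ≠ 0 := fun h0 =>
        hab (Subtype.ext (eq_of_latticeDist_eq_zero h0))
      omega
  obtain ⟨z, hz, hzx⟩ : ∃ z ∈ Z, z ≠ x := by
    by_contra hne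
    push Not at hne
    exact h (Finset.eq_singleton_iff_unique_mem.2 ⟨hx, hne⟩)
  refine ⟨z, hdist hx hz hzx.symm, ?_⟩
  ext y
  simp only [Finset.mem_insert, Finset.mem_singleton]
  constructor
  · intro hy
    by_contra hne
    push Not at hne
    have h1 := two_dvd_latticeDist_add x.1 y.1 z.1
    rw [hdist hx hy hne.1.symm, hdist hy hz hne.2, hdist hx hz hzx.symm] at h1
    omega
  · rintro (rfl | rfl) <;> assumption

open Classical in
/-- The nearest neighbours of `x` in `V`. -/
noncomputable def neighbours (x : V) : Finset V :=
  Finset.univ.filter fun z => latticeDist x.1 z.1 = 1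

lemma mem_neighbours {x z : V} : z ∈ neighbours x ↔ latticeDist x.1 z.1 = 1 := by
  simp [neighbours]

lemma card_neighbours_le (x : V) : (neighbours x).card ≤ 2 * d := by
  classical
  have h : (neighbours x).image Subtype.val ⊆
      (Finset.univ : Finset (Fin d × Bool)).image fun p =>
        Function.update x.1 p.1 (x.1 p.1 + if p.2 then 1 else -1) := by
    intro y hy
    obtain ⟨z, hz, rfl⟩ := Finset.mem_image.1 hy
    rw [mem_neighbours] at hz
    obtain ⟨i, hi⟩ : ∃ i, x.1 i ≠ z.1 i := by
      by_contra hne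
      push Not at hne
      rw [funext hne, latticeDist_self] at hz
      omega
    rw [latticeDist, ← Finset.add_sum_erase _ _ (Finset.mem_univ i)] at hz
    have h1 : ∑ j ∈ Finset.univ.erase i, (x.1 j - z.1 j).natAbs = 0 := by omega
    rw [h1] at hz
    refine Finset.mem_image.2 ⟨(i, decide (x.1 i < z.1 i)), Finset.mem_univ _, ?_⟩
    funext j
    by_cases hj : j = i
    · subst hj
      simp only [Function.update_self, decide_eq_true_eq]
      split_ifs <;> omega
    · rw [Function.update_of_ne hj]
      have := Finset.sum_eq_zero_iff.1 h1 j (Finset.mem_erase.2 ⟨hj, Finset.mem_univ j⟩)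
      omega
  calc (neighbours x).card = ((neighbours x).image Subtype.val).card :=
        (Finset.card_image_of_injective _ Subtype.val_injective).symm
    _ ≤ _ := (Finset.card_le_card h).trans Finset.card_image_le
    _ = 2 * d := by simp [mul_comm]

open Classical in
/-- The vertices and edges that contain `x`. -/
noncomputable def bondsAt (x : V) : Finset (Finset V) :=
  Finset.univ.filter fun Z => x ∈ Z ∧ diam Z ≤ 1

open Classical in
lemma bondsAt_subset (x : V) :
    bondsAt x ⊆ insert {x} ((neighbours x).image fun z => {x, z}) := by
  intro Z hZ
  obtain ⟨hx, hd⟩ := (Finset.mem_filter.1 hZ).2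
  rcases eq_singleton_or_eq_pair hd hx with h | ⟨z, hz, h⟩
  · simp [h]
  · exact Finset.mem_insert_of_mem (Finset.mem_image.2 ⟨z, mem_neighbours.2 hz, h.symm⟩)

lemma card_bondsAt_le (x : V) : (bondsAt x).card ≤ 2 * d + 1 := by
  classical
  exact (Finset.card_le_card (bondsAt_subset x)).trans ((Finset.card_insert_le _ _).trans
    (add_le_add (Finset.card_image_le.trans (card_neighbours_le x)) le_rfl))

lemma card_le_two {Z : Finset V} (hZ : diam Z ≤ 1) : Z.card ≤ 2 := by
  classical
  rcases Z.eq_empty_or_nonempty with rfl | ⟨x, hx⟩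
  · simp
  · rcases eq_singleton_or_eq_pair hZ hx with h | ⟨z, -, h⟩
    · simp [h]
    · rw [h]; exact Finset.card_le_two

open Classical in
/-- The vertices and edges that meet `Z`. -/
noncomputable def bondsMeeting (Z : Finset V) : Finset (Finset V) :=
  Finset.univ.filter fun Z' => ¬ Disjoint Z Z' ∧ diam Z' ≤ 1

open Classical in
lemma bondsMeeting_eq (Z : Finset V) : bondsMeeting Z = Z.biUnion bondsAt := by
  ext Z'
  simp only [bondsMeeting, bondsAt, Finset.mem_filter, Finset.mem_univ, true_and,
    Finset.mem_biUnion, Finset.not_disjoint_iff]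
  exact ⟨fun ⟨⟨x, h1, h2⟩, h3⟩ => ⟨x, h1, h2, h3⟩, fun ⟨x, h1, h2, h3⟩ => ⟨⟨x, h1, h2⟩, h3⟩⟩

lemma card_bondsMeeting_le {Z : Finset V} (hZ : diam Z ≤ 1) :
    (bondsMeeting Z).card ≤ 2 * (2 * d + 1) := by
  classical
  rw [bondsMeeting_eq]
  exact (Finset.card_biUnion_le_card_mul _ _ _ fun x _ => card_bondsAt_le x).trans
    (Nat.mul_le_mul_right _ (card_le_two hZ))

/-- The least value on `Z` of a function on the vertices (`0` for the empty set). -/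
noncomputable def minOn (D : V → ℝ) (Z : Finset V) : ℝ :=
  if h : Z.Nonempty then Z.inf' h D else 0

lemma minOn_le {D : V → ℝ} {Z : Finset V} {x : V} (hx : x ∈ Z) : minOn D Z ≤ D x := by
  rw [minOn, dif_pos ⟨x, hx⟩]
  exact Finset.inf'_le _ hx

lemma le_minOn {D : V → ℝ} {Z : Finset V} (hZ : Z.Nonempty) {c : ℝ} (h : ∀ x ∈ Z, c ≤ D x) :
    c ≤ minOn D Z := by
  rw [minOn, dif_pos hZ]
  exact Finset.le_inf' _ _ h

/-- A function on the vertices that drops by at most `1` along every edge. -/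
def StepLipschitz (D : V → ℝ) : Prop :=
  ∀ x y : V, latticeDist x.1 y.1 ≤ 1 → D x - 1 ≤ D y

lemma exp_minOn_sub_le {D : V → ℝ} (hD : StepLipschitz D) {Z Z' : Finset V} {x : V}
    (hx : x ∈ Z) (hx' : x ∈ Z') (hd : diam Z' ≤ 1) :
    Real.exp (minOn D Z - minOn D Z') ≤ 3 := by
  have h1 : D x - 1 ≤ minOn D Z' :=
    le_minOn ⟨x, hx'⟩ fun y hy => hD x y ((latticeDist_le_diam hx' hy).trans hd)
  have h2 : minOn D Z ≤ D x := minOn_le hx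
  refine (Real.exp_le_exp.2 (by linarith : _ ≤ (1 : ℝ))).trans ?_
  linarith [Real.exp_one_lt_d9]

open Classical in
/-- The sum of the weights of the neighbours of a bond. Only `2(2d-1)` neighbouring edges can lose a
factor `e`: this is the count which gives the Lieb–Robinson velocity. -/
lemma sum_exp_minOn_sub_le (hd : 1 ≤ d) {D : V → ℝ} (hD : StepLipschitz D) {Z : Finset V}
    (hZ : diam Z ≤ 1) :
    ∑ Z' ∈ (bondsMeeting Z).erase Z, Real.exp (minOn D Z - minOn D Z') ≤ 8 * (2 * d - 1) := by
  have hd' : (1 : ℝ) ≤ d := by exact_mod_cast hd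
  have hsum : ∀ {s : Finset (Finset V)} {x : V}, x ∈ Z → (∀ Z' ∈ s, x ∈ Z' ∧ diam Z' ≤ 1) →
      ∑ Z' ∈ s, Real.exp (minOn D Z - minOn D Z') ≤ 3 * s.card := fun {s x} hx hs => by
    refine (Finset.sum_le_card_nsmul s _ 3 fun Z' hZ' =>
      exp_minOn_sub_le hD hx (hs Z' hZ').1 (hs Z' hZ').2).trans ?_
    rw [nsmul_eq_mul, mul_comm]
  have hedge : ∀ {x z : V}, latticeDist x.1 z.1 = 1 → diam ({x, z} : Finset V) ≤ 1 :=
    fun {x z} h => by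
      have h' : latticeDist z.1 x.1 = 1 := by rw [latticeDist_comm, h]
      simp only [diam, Finset.sup_le_iff, Finset.mem_insert, Finset.mem_singleton]
      rintro _ (rfl | rfl) _ (rfl | rfl) <;> simp [latticeDist_self, h, h']
  rcases Z.eq_empty_or_nonempty with rfl | ⟨x, hx⟩
  · simp [bondsMeeting]; linarith
  rcases eq_singleton_or_eq_pair hZ hx with h | ⟨y, hxy, h⟩
  · have h1 : (bondsMeeting Z).erase Z ⊆ (neighbours x).image fun z => {x, z} := by
      intro Z' hZ'
      obtain ⟨hne, hm⟩ := Finset.mem_erase.1 hZ'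
      rw [bondsMeeting_eq, h, Finset.singleton_biUnion] at hm
      rcases Finset.mem_insert.1 (bondsAt_subset x hm) with h2 | h2
      · exact absurd (h2.trans h.symm) hne
      · exact h2
    have h2 : (((neighbours x).image fun z => ({x, z} : Finset V)).card : ℝ) ≤ 2 * d := by
      exact_mod_cast Finset.card_image_le.trans (card_neighbours_le x)
    calc _ ≤ ∑ Z' ∈ (neighbours x).image fun z => {x, z}, Real.exp (minOn D Z - minOn D Z') :=
          Finset.sum_le_sum_of_subset_of_nonneg h1 fun _ _ _ => (Real.exp_pos _).le
      _ ≤ 3 * ((neighbours x).image fun z => ({x, z} : Finset V)).card := by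
          refine hsum hx fun Z' hZ' => ?_
          obtain ⟨z, hz, rfl⟩ := Finset.mem_image.1 hZ'
          exact ⟨by simp, hedge (mem_neighbours.1 hz)⟩
      _ ≤ _ := by linarith
  · -- each endpoint contributes itself, with weight at most `1`, and its other edges
    have hend : ∀ {a b : V}, Z = {a, b} → latticeDist a.1 b.1 = 1 →
        ∑ Z' ∈ (bondsAt a).erase Z, Real.exp (minOn D Z - minOn D Z') ≤ 4 * (2 * d - 1) :=
      fun {a b} hab hdist => by
        have ha : a ∈ Z := by simp [hab]
        have h1 : (bondsAt a).erase Z ⊆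
            insert {a} (((neighbours a).erase b).image fun z => {a, z}) := by
          intro Z' hZ'
          obtain ⟨hne, hm⟩ := Finset.mem_erase.1 hZ'
          rcases Finset.mem_insert.1 (bondsAt_subset a hm) with h2 | h2
          · exact Finset.mem_insert.2 (Or.inl h2)
          · obtain ⟨z, hz, rfl⟩ := Finset.mem_image.1 h2
            refine Finset.mem_insert_of_mem (Finset.mem_image.2 ⟨z, Finset.mem_erase.2
              ⟨fun hzb => hne ?_, hz⟩, rfl⟩)
            rw [hzb, hab]
        have h2 : (((((neighbours a).erase b).image fun z => ({a, z} : Finset V)).card : ℕ) : ℝ)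
            ≤ 2 * d - 1 := by
          have h3 := Finset.card_erase_of_mem (mem_neighbours.2 hdist)
          have h4 := card_neighbours_le a
          have h5 : (((neighbours a).erase b).image fun z => ({a, z} : Finset V)).card + 1
              ≤ 2 * d := by
            have := Finset.card_image_le (s := (neighbours a).erase b)
              (f := fun z => ({a, z} : Finset V))
            omega
          have h6 : (((((neighbours a).erase b).image fun z => ({a, z} : Finset V)).card : ℕ) : ℝ)
              + 1 ≤ 2 * d := by exact_mod_cast h5
          linarith
        have h3 : Real.exp (minOn D Z - minOn D {a}) ≤ 1 := by
          rw [Real.exp_le_one_iff]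
          have : D a ≤ minOn D {a} := le_minOn (Finset.singleton_nonempty a) (by simp)
          linarith [minOn_le (D := D) ha]
        have h4 : ∑ Z' ∈ ((neighbours a).erase b).image fun z => {a, z},
            Real.exp (minOn D Z - minOn D Z') ≤ 3 * (2 * d - 1) := by
          refine (hsum ha fun Z' hZ' => ?_).trans (by linarith)
          obtain ⟨z, hz, rfl⟩ := Finset.mem_image.1 hZ'
          exact ⟨by simp, hedge (mem_neighbours.1 (Finset.mem_of_mem_erase hz))⟩
        calc _ ≤ ∑ Z' ∈ insert {a} (((neighbours a).erase b).image fun z => {a, z}),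
              Real.exp (minOn D Z - minOn D Z') :=
              Finset.sum_le_sum_of_subset_of_nonneg h1 fun _ _ _ => (Real.exp_pos _).le
          _ ≤ Real.exp (minOn D Z - minOn D {a}) +
              ∑ Z' ∈ ((neighbours a).erase b).image fun z => {a, z},
                Real.exp (minOn D Z - minOn D Z') := by
              by_cases hm : ({a} : Finset V) ∈ ((neighbours a).erase b).image fun z => {a, z}
              · rw [Finset.insert_eq_of_mem hm]; linarith [Real.exp_pos (minOn D Z - minOn D {a})]
              · rw [Finset.sum_insert hm]
          _ ≤ _ := by linarith
    have h1 : (bondsMeeting Z).erase Z ⊆ (bondsAt x).erase Z ∪ (bondsAt y).erase Z := by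
      intro Z' hZ'
      obtain ⟨hne, hm⟩ := Finset.mem_erase.1 hZ'
      rw [bondsMeeting_eq, Finset.mem_biUnion] at hm
      obtain ⟨z, hz, hz'⟩ := hm
      rw [h] at hz
      simp only [Finset.mem_insert, Finset.mem_singleton] at hz
      rcases hz with rfl | rfl
      · exact Finset.mem_union_left _ (Finset.mem_erase.2 ⟨hne, hz'⟩)
      · exact Finset.mem_union_right _ (Finset.mem_erase.2 ⟨hne, hz'⟩)
    calc _ ≤ ∑ Z' ∈ (bondsAt x).erase Z ∪ (bondsAt y).erase Z,
          Real.exp (minOn D Z - minOn D Z') :=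
          Finset.sum_le_sum_of_subset_of_nonneg h1 fun _ _ _ => (Real.exp_pos _).le
      _ ≤ ∑ Z' ∈ (bondsAt x).erase Z, Real.exp (minOn D Z - minOn D Z') +
          ∑ Z' ∈ (bondsAt y).erase Z, Real.exp (minOn D Z - minOn D Z') := by
          rw [← Finset.sum_union_inter]
          exact le_add_of_nonneg_right (Finset.sum_nonneg fun _ _ => (Real.exp_pos _).le)
      _ ≤ 4 * (2 * d - 1) + 4 * (2 * d - 1) :=
          add_le_add (hend h hxy) (hend (by rw [h, Finset.pair_comm])
            (by rw [latticeDist_comm]; exact hxy))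
      _ = _ := by ring

end Geometry

/-! ### Lieb–Robinson bounds for interactions of range one -/

section Interaction

open Complex

variable {d : ℕ} {V : Finset (Fin d → ℤ)} {n : V → ℕ} {Φ : Finset V → Observable n} {J : ℝ}

lemma velocity_pos (hd : 1 ≤ d) (hJ : 0 < J) : 0 < velocity d J := by
  have hd' : (1 : ℝ) ≤ d := by exact_mod_cast hd
  have : (0 : ℝ) < 2 * d - 1 := by linarith
  rw [velocity]; positivity

lemma IsInteraction.diam_le_one (hΦ : IsInteraction n Φ J) {Z : Finset V} (h : Φ Z ≠ 0) :
    diam Z ≤ 1 := by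
  by_contra hd
  exact h (hΦ.range_one Z (not_le.1 hd))

lemma isSelfAdjoint_sum {ι κ : Type*} [Fintype ι] {f : κ → Matrix ι ι ℂ} (s : Finset κ)
    (h : ∀ k, IsSelfAdjoint (f k)) : IsSelfAdjoint (∑ k ∈ s, f k) := by
  rw [isSelfAdjoint_iff, star_sum]; exact Finset.sum_congr rfl fun k _ => h k

lemma IsInteraction.isSelfAdjoint_hamiltonian (hΦ : IsInteraction n Φ J) :
    IsSelfAdjoint (hamiltonian Φ) := isSelfAdjoint_sum _ hΦ.selfAdjoint

lemma norm_lie_le_of_mem_unitary {a W : Observable n} (hW : W ∈ unitary (Observable n)) :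
    ‖⁅a, W⁆‖ ≤ 2 * ‖a‖ := by
  refine (norm_lie_le a W).trans ?_
  nlinarith [norm_le_one_of_mem_unitary hW, norm_nonneg a]

/-- Lieb–Robinson bound for an interaction of range `1`; the distance to the support `Y` of `W` is
measured by any step-Lipschitz function that is not positive on `Y`. -/
theorem IsInteraction.lieb_robinson (hΦ : IsInteraction n Φ J) (hd : 1 ≤ d) (hJ : 0 < J)
    {W : Observable n} (hW : W ∈ unitary (Observable n)) {Y : Finset V}
    (hWY : W ∈ localAlgebra n Y) {D : V → ℝ} (hD : StepLipschitz D) (hDY : ∀ x ∈ Y, D x ≤ 0)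
    (Z : Finset V) (t : ℝ) :
    ‖⁅heis (hamiltonian Φ) t (Φ Z), W⁆‖
      ≤ 2 * J * Real.exp (4 * velocity d J * |t| - minOn D Z) := by
  classical
  refine SpinLattice.lieb_robinson Φ hΦ.selfAdjoint W (fun Z => (bondsMeeting Z).erase Z) ?_
    (minOn D) (J := J) ?_ hΦ.norm_le ?_ ?_ Z t
  · intro Z Z' hZ'
    by_cases h1 : Z' = Z
    · rw [h1]; exact Commute.refl _
    by_cases h2 : Φ Z' = 0
    · rw [h2]; exact Commute.zero_right _
    have h3 : Disjoint Z Z' := by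
      by_contra h3
      exact hZ' (Finset.mem_erase.2 ⟨h1, Finset.mem_filter.2
        ⟨Finset.mem_univ _, h3, hΦ.diam_le_one h2⟩⟩)
    exact commute_of_disjoint h3 (hΦ.mem_local Z) (hΦ.mem_local Z')
  · linarith [velocity_pos hd hJ]
  · intro Z hZ
    rw [velocity]
    calc _ ≤ 2 * J * (8 * (2 * d - 1)) := by
          gcongr; exact sum_exp_minOn_sub_le hd hD (hΦ.diam_le_one hZ)
      _ = _ := by ring
  · intro Z
    by_cases h : Disjoint Z Y
    · rw [commute_iff_lie_eq.1 (commute_of_disjoint h (hΦ.mem_local Z) hWY)]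
      simp; positivity
    · obtain ⟨x, hxZ, hxY⟩ := Finset.not_disjoint_iff.1 h
      have h1 : minOn D Z ≤ 0 := (minOn_le hxZ).trans (hDY x hxY)
      calc _ ≤ 1 * (2 * ‖Φ Z‖) := by
            gcongr
            · exact Real.exp_le_one_iff.2 h1
            · exact norm_lie_le_of_mem_unitary hW
        _ ≤ _ := by linarith [hΦ.norm_le Z]

open Classical in
/-- Pairs of bonds that meet, the first in `N` and the second in `S`. -/
noncomputable def meetingPairs (N S : Finset (Finset V)) : Finset (Finset V × Finset V) :=
  (N ×ˢ S).filter fun p => ¬ Disjoint p.1 p.2 ∧ diam p.1 ≤ 1 ∧ diam p.2 ≤ 1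

lemma card_meetingPairs_le (N S : Finset (Finset V)) :
    (meetingPairs N S).card ≤ (N.filter fun Z => diam Z ≤ 1).card * (2 * (2 * d + 1)) := by
  classical
  have h : meetingPairs N S ⊆ (N.filter fun Z => diam Z ≤ 1).biUnion fun Z =>
      (bondsMeeting Z).image fun Z' => (Z, Z') := by
    rintro ⟨Z, Z'⟩ hp
    simp only [meetingPairs, Finset.mem_filter, Finset.mem_product] at hp
    refine Finset.mem_biUnion.2 ⟨Z, Finset.mem_filter.2 ⟨hp.1.1, hp.2.2.1⟩,
      Finset.mem_image.2 ⟨Z', Finset.mem_filter.2 ⟨Finset.mem_univ _, hp.2.1, hp.2.2.2⟩, rfl⟩⟩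
  refine (Finset.card_le_card h).trans (Finset.card_biUnion_le_card_mul _ _ _ fun Z hZ => ?_)
  exact Finset.card_image_le.trans (card_bondsMeeting_le (Finset.mem_filter.1 hZ).2)

/-- The commutator of the Hamiltonian with the part of it carried by `S` only involves the bonds of
`S` that meet a bond of `N`, if every bond off `S` that meets a bond of `S` belongs to `N`. -/
lemma IsInteraction.lie_hamiltonian_sum (hΦ : IsInteraction n Φ J) {N S : Finset (Finset V)}
    (hNS : Disjoint N S)
    (hN : ∀ Z ∈ S, ∀ Z' ∉ S, diam Z ≤ 1 → diam Z' ≤ 1 → ¬ Disjoint Z' Z → Z' ∈ N) :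
    ⁅hamiltonian Φ, ∑ Z ∈ S, Φ Z⁆ = ∑ p ∈ meetingPairs N S, ⁅Φ p.1, Φ p.2⁆ := by
  classical
  have h1 : ⁅∑ Z ∈ S, Φ Z, ∑ Z ∈ S, Φ Z⁆ = 0 := by simp [Ring.lie_def]
  have h2 : ⁅hamiltonian Φ, ∑ Z ∈ S, Φ Z⁆ = ⁅∑ Z ∈ Sᶜ, Φ Z, ∑ Z ∈ S, Φ Z⁆ := by
    have h3 : hamiltonian Φ = ∑ Z ∈ S, Φ Z + ∑ Z ∈ Sᶜ, Φ Z := by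
      rw [hamiltonian, Finset.sum_add_sum_compl]
    rw [h3, Ring.lie_def, Ring.lie_def, add_mul, mul_add]; abel
  have h3 : ⁅∑ Z ∈ Sᶜ, Φ Z, ∑ Z ∈ S, Φ Z⁆ = ∑ p ∈ Sᶜ ×ˢ S, ⁅Φ p.1, Φ p.2⁆ := by
    simp only [Ring.lie_def, Finset.sum_product, Finset.sum_mul, Finset.mul_sum,
      Finset.sum_sub_distrib]
    congr 1
    exact Finset.sum_comm
  rw [h2, h3]
  symm
  refine Finset.sum_subset ?_ ?_
  · rintro ⟨Z, Z'⟩ hp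
    simp only [meetingPairs, Finset.mem_filter, Finset.mem_product] at hp
    exact Finset.mem_product.2 ⟨Finset.mem_compl.2 (Finset.disjoint_left.1 hNS hp.1.1), hp.1.2⟩
  · rintro ⟨Z, Z'⟩ hp hp'
    simp only [Finset.mem_product, Finset.mem_compl] at hp
    by_cases hz : Φ Z = 0
    · simp [hz, Ring.lie_def]
    by_cases hz' : Φ Z' = 0
    · simp [hz', Ring.lie_def]
    have hdj : Disjoint Z Z' := by
      by_contra hdj
      exact hp' (Finset.mem_filter.2 ⟨Finset.mem_product.2
        ⟨hN _ hp.2 _ hp.1 (hΦ.diam_le_one hz') (hΦ.diam_le_one hz) hdj, hp.2⟩,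
        hdj, hΦ.diam_le_one hz, hΦ.diam_le_one hz'⟩)
    exact commute_iff_lie_eq.1 (commute_of_disjoint hdj (hΦ.mem_local Z) (hΦ.mem_local Z'))

lemma IsInteraction.norm_lie_le (hΦ : IsInteraction n Φ J) (hJ : 0 < J) (Z Z' : Finset V) :
    ‖⁅Φ Z, Φ Z'⁆‖ ≤ 2 * J ^ 2 := by
  refine (SpinLattice.norm_lie_le _ _).trans ?_
  rw [pow_two, ← mul_assoc]
  gcongr <;> exact hΦ.norm_le _

lemma IsInteraction.norm_lie_hamiltonian_sum_le (hΦ : IsInteraction n Φ J) (hJ : 0 < J)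
    {N S : Finset (Finset V)} (hNS : Disjoint N S)
    (hN : ∀ Z ∈ S, ∀ Z' ∉ S, diam Z ≤ 1 → diam Z' ≤ 1 → ¬ Disjoint Z' Z → Z' ∈ N) :
    ‖⁅hamiltonian Φ, ∑ Z ∈ S, Φ Z⁆‖ ≤ (meetingPairs N S).card * (2 * J ^ 2) := by
  rw [hΦ.lie_hamiltonian_sum hNS hN, ← nsmul_eq_mul]
  exact (norm_sum_le _ _).trans (Finset.sum_le_card_nsmul _ _ _ fun p _ => hΦ.norm_lie_le hJ _ _)

lemma norm_lie_lie_le (a b W : Observable n) :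
    ‖⁅⁅a, b⁆, W⁆‖ ≤ 2 * ‖a‖ * ‖⁅b, W⁆‖ + 2 * ‖b‖ * ‖⁅a, W⁆‖ := by
  have h : ⁅⁅a, b⁆, W⁆ = ⁅a, ⁅b, W⁆⁆ - ⁅b, ⁅a, W⁆⁆ := by
    simp only [Ring.lie_def]; noncomm_ring
  rw [h]
  exact (norm_sub_le _ _).trans (add_le_add (SpinLattice.norm_lie_le _ _)
    (SpinLattice.norm_lie_le _ _))

/-- Up to time `T`, the evolution of the part of the Hamiltonian carried by `S` almost commutes with
unitaries at distance `m` from `S`: by the equation of motion only the bonds at the edge of `S`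
matter. -/
theorem IsInteraction.norm_lie_heis_sum_le (hΦ : IsInteraction n Φ J) (hd : 1 ≤ d) (hJ : 0 < J)
    {N S : Finset (Finset V)} (hNS : Disjoint N S)
    (hN : ∀ Z ∈ S, ∀ Z' ∉ S, diam Z ≤ 1 → diam Z' ≤ 1 → ¬ Disjoint Z' Z → Z' ∈ N)
    {W : Observable n} (hW : W ∈ unitary (Observable n)) {X : Finset V}
    (hWX : W ∈ localAlgebra n Xᶜ) (hSX : ∑ Z ∈ S, Φ Z ∈ localAlgebra n X) {D : V → ℝ}
    (hD : StepLipschitz D) (hDX : ∀ x ∉ X, D x ≤ 0) {m : ℝ} (hm : ∀ Z ∈ S, ∀ x ∈ Z, m ≤ D x)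
    {t T : ℝ} (ht : |t| ≤ T) :
    ‖⁅heis (hamiltonian Φ) t (∑ Z ∈ S, Φ Z), W⁆‖ ≤ (meetingPairs N S).card *
      (8 * J ^ 2 * Real.exp (4 * velocity d J * T - m + 1)) * T := by
  classical
  set H := hamiltonian Φ
  have hH : IsSelfAdjoint H := hΦ.isSelfAdjoint_hamiltonian
  set C := (meetingPairs N S).card * (8 * J ^ 2 * Real.exp (4 * velocity d J * T - m + 1))
  have hv := (velocity_pos hd hJ).le
  have hder : ∀ s, HasDerivAt (fun s => ⁅heis H s (∑ Z ∈ S, Φ Z), W⁆)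
      ⁅heis H s (I • ⁅H, ∑ Z ∈ S, Φ Z⁆), W⁆ s := fun s => by
    have h1 := hasDerivAt_heis H (∑ Z ∈ S, Φ Z) s
    exact (h1.mul_const W).sub (h1.const_mul W)
  have hbound : ∀ s, |s| ≤ |t| → ‖⁅heis H s (I • ⁅H, ∑ Z ∈ S, Φ Z⁆), W⁆‖ ≤ C := fun s hs => by
    have h1 : ⁅heis H s (I • ⁅H, ∑ Z ∈ S, Φ Z⁆), W⁆ =
        I • ∑ p ∈ meetingPairs N S, ⁅heis H s ⁅Φ p.1, Φ p.2⁆, W⁆ := by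
      rw [hΦ.lie_hamiltonian_sum hNS hN, heis_smul, heis_sum, ← sum_lie_left]
      simp only [Ring.lie_def, smul_sub, smul_mul_assoc, mul_smul_comm]
    rw [h1, norm_smul, Complex.norm_I, one_mul]
    refine (norm_sum_le _ _).trans ?_
    rw [show C = (meetingPairs N S).card • (8 * J ^ 2 *
      Real.exp (4 * velocity d J * T - m + 1)) from (nsmul_eq_mul _ _).symm]
    refine Finset.sum_le_card_nsmul _ _ _ fun p hp => ?_
    simp only [meetingPairs, Finset.mem_filter, Finset.mem_product] at hp
    obtain ⟨⟨-, hpS⟩, hdj, hd1, -⟩ := hp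
    obtain ⟨x, hx1, hx2⟩ := Finset.not_disjoint_iff.1 hdj
    have hLR : ∀ Z : Finset V, m - 1 ≤ minOn D Z →
        ‖⁅heis H s (Φ Z), W⁆‖ ≤ 2 * J * Real.exp (4 * velocity d J * T - m + 1) := fun Z hZ => by
      refine (hΦ.lieb_robinson hd hJ hW hWX hD
        (fun x hx => hDX x (Finset.mem_compl.1 hx)) Z s).trans ?_
      have : 4 * velocity d J * |s| ≤ 4 * velocity d J * T := by
        gcongr; exact hs.trans ht
      gcongr
      linarith
    have h2 := hLR p.2 (by linarith [le_minOn (D := D) ⟨x, hx2⟩ (hm _ hpS)])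
    have h3 := hLR p.1 (le_minOn ⟨x, hx1⟩ fun y hy => by
      linarith [hD x y ((latticeDist_le_diam hx1 hy).trans hd1), hm _ hpS x hx2])
    rw [heis_lie]
    refine (norm_lie_lie_le _ _ _).trans ?_
    rw [norm_heis hH, norm_heis hH]
    calc _ ≤ 2 * J * (2 * J * Real.exp (4 * velocity d J * T - m + 1)) +
          2 * J * (2 * J * Real.exp (4 * velocity d J * T - m + 1)) := by
          gcongr <;> exact hΦ.norm_le _
      _ = _ := by ring
  have h0 : ⁅heis H 0 (∑ Z ∈ S, Φ Z), W⁆ = 0 := by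
    rw [heis_zero]
    exact commute_iff_lie_eq.1 (commute_of_mem_localAlgebra_compl hSX hWX)
  have key := norm_sub_le_of_hasDerivAt hder hbound
  rw [h0, sub_zero] at key
  exact key.trans (by gcongr)

/-- The evolution of the part of the Hamiltonian carried by `N` almost commutes with unitaries far
from `N`. -/
theorem IsInteraction.norm_lie_heis_sum_le_card (hΦ : IsInteraction n Φ J) (hd : 1 ≤ d)
    (hJ : 0 < J) {N : Finset (Finset V)} {W : Observable n} (hW : W ∈ unitary (Observable n))
    {Y : Finset V} (hWY : W ∈ localAlgebra n Y) {D : V → ℝ} (hD : StepLipschitz D)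
    (hDY : ∀ x ∈ Y, D x ≤ 0) {m : ℝ} (hm : ∀ Z ∈ N, Z.Nonempty → diam Z ≤ 1 → m ≤ minOn D Z)
    {t T : ℝ} (ht : |t| ≤ T) :
    ‖⁅heis (hamiltonian Φ) t (∑ Z ∈ N, Φ Z), W⁆‖ ≤
      (N.filter fun Z => diam Z ≤ 1).card *
        (2 * J * Real.exp (4 * velocity d J * T - m)) := by
  have hv := (velocity_pos hd hJ).le
  have h1 : ∑ Z ∈ N, Φ Z = ∑ Z ∈ N.filter fun Z => diam Z ≤ 1, Φ Z :=
    (Finset.sum_filter_of_ne fun Z _ hZ => hΦ.diam_le_one hZ).symm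
  rw [h1, heis_sum, sum_lie_left, ← nsmul_eq_mul]
  refine (norm_sum_le _ _).trans (Finset.sum_le_card_nsmul _ _ _ fun Z hZ => ?_)
  obtain ⟨hZN, hZd⟩ := Finset.mem_filter.1 hZ
  rcases Z.eq_empty_or_nonempty with rfl | hne
  · have h2 : Commute (Φ ∅) (hamiltonian Φ) := Commute.sum_right _ _ _ fun Z _ =>
      commute_of_disjoint (Finset.disjoint_empty_left Z) (hΦ.mem_local ∅) (hΦ.mem_local Z)
    rw [heis_eq_self h2, commute_iff_lie_eq.1
      (commute_of_disjoint (Finset.disjoint_empty_left Y) (hΦ.mem_local ∅) hWY), norm_zero]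
    positivity
  refine (hΦ.lieb_robinson hd hJ hW hWY hD hDY Z t).trans ?_
  have : 4 * velocity d J * |t| ≤ 4 * velocity d J * T := by gcongr
  have := hm Z hZN hne hZd
  gcongr

end Interaction

/-! ### Regions deep inside, deep outside, and near the boundary -/

section Boundary

open Complex

variable {d : ℕ} {V : Finset (Fin d → ℤ)}

lemma mem_boundary {A : Finset V} {x : V} :
    x ∈ boundary A ↔ x ∈ A ∧ ∃ y : V, y ∉ A ∧ latticeDist x.1 y.1 ≤ 1 := by
  simp [boundary]

/-- The distance of `x` to `∂A`. -/
noncomputable def bdDist (A : Finset V) (x : V) : ℕ :=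
  sInf ((fun y : V => latticeDist x.1 y.1) '' boundary A)

lemma bdDist_le {A : Finset V} {y : V} (hy : y ∈ boundary A) (x : V) :
    bdDist A x ≤ latticeDist x.1 y.1 :=
  Nat.sInf_le ⟨y, hy, rfl⟩

lemma exists_latticeDist_eq_bdDist {A : Finset V} (hA : (boundary A).Nonempty) (x : V) :
    ∃ y ∈ boundary A, latticeDist x.1 y.1 = bdDist A x := by
  obtain ⟨y, hy⟩ := hA
  obtain ⟨z, hz, h⟩ := Nat.sInf_mem (s := (fun y : V => latticeDist x.1 y.1) '' boundary A)
    ⟨_, y, hy, rfl⟩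
  exact ⟨z, hz, h⟩

lemma bdDist_le_add_one {A : Finset V} (hA : (boundary A).Nonempty) {x y : V}
    (h : latticeDist x.1 y.1 ≤ 1) : bdDist A x ≤ bdDist A y + 1 := by
  obtain ⟨z, hz, hyz⟩ := exists_latticeDist_eq_bdDist hA y
  have h1 := bdDist_le hz x
  have h2 := latticeDist_triangle x.1 y.1 z.1
  omega

lemma bdDist_eq_zero {A : Finset V} {x : V} (hx : x ∈ boundary A) : bdDist A x = 0 := by
  have := bdDist_le hx x
  rw [latticeDist_self] at this
  omega

open Classical in
/-- The distance to `∂A`, cut off to `0` outside `R`. -/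
noncomputable def depth (A R : Finset V) (x : V) : ℝ := if x ∈ R then bdDist A x else 0

lemma stepLipschitz_depth_self {A : Finset V} (hA : (boundary A).Nonempty) :
    StepLipschitz (depth A A) := by
  intro x y h
  have h1 : (bdDist A x : ℝ) ≤ bdDist A y + 1 := by exact_mod_cast bdDist_le_add_one hA h
  by_cases hx : x ∈ A
  · by_cases hy : y ∈ A
    · simp only [depth, hx, hy, if_true]; linarith
    · have := bdDist_eq_zero (mem_boundary.2 ⟨hx, y, hy, h⟩)
      simp [depth, hx, hy, this]
  · simp only [depth, hx, if_false]
    split_ifs <;> linarith [(Nat.cast_nonneg (bdDist A y) : (0 : ℝ) ≤ _)]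

lemma stepLipschitz_depth_compl {A : Finset V} (hA : (boundary A).Nonempty) :
    StepLipschitz (depth A Aᶜ) := by
  intro x y h
  have h1 : (bdDist A x : ℝ) ≤ bdDist A y + 1 := by exact_mod_cast bdDist_le_add_one hA h
  by_cases hx : x ∈ A
  · simp only [depth, Finset.mem_compl, hx, not_true, if_false]
    split_ifs <;> linarith [(Nat.cast_nonneg (bdDist A y) : (0 : ℝ) ≤ _)]
  · by_cases hy : y ∈ A
    · have h2 := bdDist_eq_zero (mem_boundary.2 ⟨hy, x, hx, by rwa [latticeDist_comm]⟩)
      rw [h2] at h1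
      simp only [depth, Finset.mem_compl, hx, hy, not_true, not_false_iff, if_true, if_false]
      push_cast at h1; linarith
    · simp only [depth, Finset.mem_compl, hx, hy, not_false_iff, if_true]; linarith

lemma stepLipschitz_sub_bdDist {A : Finset V} (hA : (boundary A).Nonempty) (ℓ : ℝ) :
    StepLipschitz fun x => ℓ - bdDist A x := by
  intro x y h
  have h1 : (bdDist A y : ℝ) ≤ bdDist A x + 1 := by
    exact_mod_cast bdDist_le_add_one hA (by rwa [latticeDist_comm])
  simp only; linarith

open Classical in
/-- The regions inside `R` at distance more than `m` from `∂A`. -/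
noncomputable def deepRegions (A R : Finset V) (m : ℝ) : Finset (Finset V) :=
  Finset.univ.filter fun Z => Z.Nonempty ∧ Z ⊆ R ∧ ∀ x ∈ Z, m < bdDist A x

open Classical in
/-- The regions that are not deep inside `A` or deep inside its complement. -/
noncomputable def nearRegions (A : Finset V) (m : ℝ) : Finset (Finset V) :=
  (deepRegions A A m ∪ deepRegions A Aᶜ m)ᶜ

lemma disjoint_deepRegions (A : Finset V) (m : ℝ) :
    Disjoint (deepRegions A A m) (deepRegions A Aᶜ m) := by
  classical
  refine Finset.disjoint_left.2 fun Z h1 h2 => ?_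
  simp only [deepRegions, Finset.mem_filter, Finset.mem_univ, true_and] at h1 h2
  obtain ⟨x, hx⟩ := h1.1
  exact Finset.mem_compl.1 (h2.2.1 hx) (h1.2.1 hx)

lemma sum_regions {E : Type*} [AddCommMonoid E] (A : Finset V) (m : ℝ) (f : Finset V → E) :
    ∑ Z, f Z = ∑ Z ∈ deepRegions A A m, f Z + ∑ Z ∈ deepRegions A Aᶜ m, f Z
      + ∑ Z ∈ nearRegions A m, f Z := by
  classical
  rw [← Finset.sum_union (disjoint_deepRegions A m), nearRegions, Finset.sum_add_sum_compl]

lemma exists_bdDist_le_of_mem_nearRegions {A Z : Finset V} {m : ℝ} (hm : 0 ≤ m)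
    (hZ : Z ∈ nearRegions A m) (hd : diam Z ≤ 1) (hne : Z.Nonempty) :
    ∃ x ∈ Z, (bdDist A x : ℝ) ≤ m := by
  classical
  by_contra h
  push Not at h
  simp only [nearRegions, deepRegions, Finset.mem_compl, Finset.mem_union, Finset.mem_filter,
    Finset.mem_univ, true_and, not_or, not_and] at hZ
  obtain ⟨x, hxZ, hxA⟩ : ∃ x ∈ Z, x ∈ A := by
    by_contra hne'
    push Not at hne'
    exact hZ.2 hne (fun x hx => Finset.mem_compl.2 (hne' x hx)) h
  obtain ⟨y, hyZ, hyA⟩ : ∃ y ∈ Z, y ∉ A := by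
    by_contra hne'
    push Not at hne'
    exact hZ.1 hne hne' h
  have h1 := bdDist_eq_zero
    (mem_boundary.2 ⟨hxA, y, hyA, (latticeDist_le_diam hxZ hyZ).trans hd⟩)
  have h2 := h x hxZ
  rw [h1] at h2
  exact absurd h2 (by simpa using hm)

lemma card_ball_le (y : V) (k : ℕ) [DecidablePred fun x : V => latticeDist x.1 y.1 ≤ k] :
    (Finset.univ.filter fun x : V => latticeDist x.1 y.1 ≤ k).card ≤ (2 * k + 1) ^ d := by
  classical
  rw [← Finset.card_image_of_injective _ Subtype.val_injective]
  calc _ ≤ (Fintype.piFinset fun i => Finset.Icc (y.1 i - k) (y.1 i + k)).card := by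
        refine Finset.card_le_card fun z hz => ?_
        obtain ⟨x, hx, rfl⟩ := Finset.mem_image.1 hz
        rw [Fintype.mem_piFinset]
        intro i
        have h1 := Finset.single_le_sum (f := fun i => (x.1 i - y.1 i).natAbs)
          (fun _ _ => Nat.zero_le _) (Finset.mem_univ i)
        have h2 : (x.1 i - y.1 i).natAbs ≤ k := h1.trans (Finset.mem_filter.1 hx).2
        rw [Finset.mem_Icc]
        omega
    _ = (2 * k + 1) ^ d := by
        rw [Fintype.card_piFinset]
        have : ∀ i, (Finset.Icc (y.1 i - (k : ℤ)) (y.1 i + k)).card = 2 * k + 1 := fun i => by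
          rw [Int.card_Icc]; omega
        simp [this]

open Classical in
/-- Up to polynomial factors in `m`, the number of bonds near the boundary is `|∂A|`. -/
lemma card_nearRegions_le {A : Finset V} (hA : (boundary A).Nonempty) {m : ℝ} (hm : 0 ≤ m) :
    (((nearRegions A m).filter fun Z => diam Z ≤ 1).card : ℝ) ≤
      (boundary A).card * (2 * m + 1) ^ d * (2 * d + 2) := by
  have h : ((nearRegions A m).filter fun Z => diam Z ≤ 1) ⊆
      insert ∅ (((boundary A).biUnion fun y =>
        Finset.univ.filter fun x : V => latticeDist x.1 y.1 ≤ ⌊m⌋₊).biUnion bondsAt) := by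
    intro Z hZ
    obtain ⟨hZn, hZd⟩ := Finset.mem_filter.1 hZ
    rcases Z.eq_empty_or_nonempty with rfl | hne
    · exact Finset.mem_insert_self _ _
    refine Finset.mem_insert_of_mem ?_
    obtain ⟨x, hx, hxm⟩ := exists_bdDist_le_of_mem_nearRegions hm hZn hZd hne
    obtain ⟨y, hy, hxy⟩ := exists_latticeDist_eq_bdDist hA x
    rw [Finset.mem_biUnion]
    refine ⟨x, Finset.mem_biUnion.2 ⟨y, hy, Finset.mem_filter.2 ⟨Finset.mem_univ _, ?_⟩⟩,
      Finset.mem_filter.2 ⟨Finset.mem_univ _, hx, hZd⟩⟩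
    rw [hxy]; exact Nat.le_floor hxm
  have h1 : ((nearRegions A m).filter fun Z => diam Z ≤ 1).card ≤
      (boundary A).card * (2 * ⌊m⌋₊ + 1) ^ d * (2 * d + 1) + 1 := by
    refine (Finset.card_le_card h).trans ((Finset.card_insert_le _ _).trans ?_)
    gcongr
    refine (Finset.card_biUnion_le_card_mul _ _ _ fun x _ => card_bondsAt_le x).trans ?_
    gcongr
    exact Finset.card_biUnion_le_card_mul _ _ _ fun y _ => card_ball_le y _
  calc _ ≤ (((boundary A).card * (2 * ⌊m⌋₊ + 1) ^ d * (2 * d + 1) + 1 : ℕ) : ℝ) := by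
        exact_mod_cast h1
    _ ≤ (boundary A).card * (2 * m + 1) ^ d * (2 * d + 1) + 1 := by
        push_cast
        gcongr
        exact Nat.floor_le hm
    _ ≤ _ := by
        have h2 : (1 : ℝ) ≤ (boundary A).card := by exact_mod_cast hA.card_pos
        have h3 : (1 : ℝ) ≤ (2 * m + 1) ^ d := one_le_pow₀ (by linarith)
        nlinarith [mul_le_mul h2 h3 zero_le_one (by linarith)]

end Boundary

/-! ### The approximation with explicit errors -/

section Approximation

open Complex MeasureTheory

variable {d : ℕ} {V : Finset (Fin d → ℤ)} {n : V → ℕ} {Φ : Finset V → Observable n} {γ J : ℝ}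

lemma heis_sub_smul_one {ι : Type*} [Fintype ι] [DecidableEq ι] (H a : Matrix ι ι ℂ) (c t : ℝ) :
    heis (H - (c : ℂ) • 1) t a = heis H t a := by
  have h := heis_add_smul_one H (-c) t a
  rw [← h]
  congr 1
  push_cast
  rw [neg_smul, sub_eq_add_neg]

lemma isSelfAdjoint_real_smul_one {ι : Type*} [Fintype ι] [DecidableEq ι] (c : ℝ) :
    IsSelfAdjoint ((c : ℂ) • (1 : Matrix ι ι ℂ)) := by
  rw [isSelfAdjoint_iff]; simp

lemma lie_sub_smul_one_left {ι : Type*} [Fintype ι] [DecidableEq ι] (a b : Matrix ι ι ℂ)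
    (c : ℂ) : ⁅a - c • 1, b⁆ = ⁅a, b⁆ := by
  simp [Ring.lie_def, sub_mul, mul_sub]

lemma lie_sub_smul_one_right {ι : Type*} [Fintype ι] [DecidableEq ι] (a b : Matrix ι ι ℂ)
    (c : ℂ) : ⁅a, b - c • 1⁆ = ⁅a, b⁆ := by
  simp [Ring.lie_def, sub_mul, mul_sub]

lemma heis_sub_smul_one_right {ι : Type*} [Fintype ι] [DecidableEq ι] (H a : Matrix ι ι ℂ)
    (c : ℂ) (t : ℝ) : heis H t (a - c • 1) = heis H t a - c • 1 := by
  rw [heis_sub, heis_smul, heis_one]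

lemma mem_deepRegions {A R Z : Finset V} {m : ℝ} :
    Z ∈ deepRegions A R m ↔ Z.Nonempty ∧ Z ⊆ R ∧ ∀ x ∈ Z, m < bdDist A x := by
  simp [deepRegions]

lemma IsInteraction.sum_deepRegions_mem (hΦ : IsInteraction n Φ J) (A R : Finset V) (m : ℝ) :
    ∑ Z ∈ deepRegions A R m, Φ Z ∈ localAlgebra n R :=
  sum_mem_localAlgebra fun Z hZ => localAlgebra_mono (mem_deepRegions.1 hZ).2.1 (hΦ.mem_local Z)

/-- The bound on `|[H, H_S]|` and on `|[τ_t(H_S), W]|`, for `S` the bonds deep inside `A` or deep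
inside its complement. -/
lemma IsInteraction.deepRegions_bounds (hΦ : IsInteraction n Φ J) (hd : 1 ≤ d) (hJ : 0 < J)
    {A R : Finset V} (hA : (boundary A).Nonempty) (hR : R = A ∨ R = Aᶜ) {m T M : ℝ}
    (hM : (((nearRegions A m).filter fun Z => diam Z ≤ 1).card : ℝ) ≤ M) :
    ‖⁅hamiltonian Φ, ∑ Z ∈ deepRegions A R m, Φ Z⁆‖ ≤ M * (2 * (2 * d + 1)) * (2 * J ^ 2) ∧
    ∀ W ∈ unitary (Observable n), W ∈ localAlgebra n Rᶜ → ∀ t, |t| ≤ T →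
      ‖⁅heis (hamiltonian Φ) t (∑ Z ∈ deepRegions A R m, Φ Z), W⁆‖ ≤
        M * (2 * (2 * d + 1)) * (8 * J ^ 2 * Real.exp (4 * velocity d J * T - m + 1)) * T := by
  classical
  have hdis : Disjoint (nearRegions A m) (deepRegions A R m) := by
    rw [Finset.disjoint_left]
    intro Z h1 h2
    refine Finset.mem_compl.1 h1 ?_
    rcases hR with rfl | rfl
    · exact Finset.mem_union_left _ h2
    · exact Finset.mem_union_right _ h2
  have hnear : ∀ Z ∈ deepRegions A R m, ∀ Z' ∉ deepRegions A R m, diam Z ≤ 1 → diam Z' ≤ 1 →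
      ¬ Disjoint Z' Z → Z' ∈ nearRegions A m := by
    intro Z hZ Z' hZ' _ _ hdj
    obtain ⟨x, hx', hx⟩ := Finset.not_disjoint_iff.1 hdj
    have hxR := (mem_deepRegions.1 hZ).2.1 hx
    refine Finset.mem_compl.2 fun h => ?_
    rcases hR with rfl | rfl
    · rcases Finset.mem_union.1 h with h | h
      · exact hZ' h
      · exact Finset.mem_compl.1 ((mem_deepRegions.1 h).2.1 hx') hxR
    · rcases Finset.mem_union.1 h with h | h
      · exact Finset.mem_compl.1 hxR ((mem_deepRegions.1 h).2.1 hx')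
      · exact hZ' h
  have hcard : ((meetingPairs (nearRegions A m) (deepRegions A R m)).card : ℝ) ≤
      M * (2 * (2 * d + 1)) := by
    refine le_trans ?_ (mul_le_mul_of_nonneg_right hM (by positivity))
    exact_mod_cast card_meetingPairs_le (nearRegions A m) (deepRegions A R m)
  have hD : StepLipschitz (depth A R) := by
    rcases hR with rfl | rfl
    · exact stepLipschitz_depth_self hA
    · exact stepLipschitz_depth_compl hA
  refine ⟨(hΦ.norm_lie_hamiltonian_sum_le hJ hdis hnear).trans (by gcongr), ?_⟩
  intro W hW hWR t ht
  refine (hΦ.norm_lie_heis_sum_le hd hJ hdis hnear hW hWR (hΦ.sum_deepRegions_mem A R m) hD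
    (fun x hx => by simp [depth, hx]) (m := m) (fun Z hZ x hx => ?_) ht).trans ?_
  · have := mem_deepRegions.1 hZ
    rw [depth, if_pos (this.2.1 hx)]
    exact (this.2.2 x hx).le
  · have : 0 ≤ T := (abs_nonneg t).trans ht
    gcongr

lemma nonempty_of_norm_eq_one {ι : Type*} [Fintype ι] {ψ : EuclideanSpace ℂ ι}
    (hψ : ‖ψ‖ = 1) : Nonempty ι := by
  by_contra h
  rw [not_nonempty_iff] at h
  have : ψ = 0 := Subsingleton.elim _ _
  simp [this] at hψ

set_option maxHeartbeats 1000000 in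
/-- The approximation theorem with explicit errors: `m` is the depth at which the interior and
exterior Hamiltonians start, `T₁` and `T₂` are the cut-offs of the two filters, `a` is the
threshold of the spectral projections, and `M` bounds the number of bonds near the boundary. -/
theorem exists_approx (hd : 1 ≤ d) (hγ : 0 < γ) (hJ : 0 < J) (hΦ : IsInteraction n Φ J)
    {ψ : EuclideanSpace ℂ (Config n)} (hψ : IsGappedGroundState (hamiltonian Φ) ψ γ)
    {A : Finset V} (hA : (boundary A).Nonempty) {ℓ m T₁ T₂ a M : ℝ} (hm : 0 ≤ m) (ha : 0 < a)
    (hT₁ : 4 ≤ γ * T₁) (hT₂ : 4 ≤ γ * T₂)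
    (hM : (((nearRegions A m).filter fun Z => diam Z ≤ 1).card : ℝ) ≤ M) :
    ∃ PA ∈ localAlgebra n A, ∃ PAc ∈ localAlgebra n Aᶜ,
    ∃ PB ∈ localAlgebra n (boundaryNhd A ℓ),
      IsStarProjection PA ∧ IsStarProjection PAc ∧ ‖PB‖ ≤ 1 ∧
      ‖PB * PA * PAc - rankOneProj ψ‖ ≤
        M * (2 * J * Real.exp (4 * velocity d J * (T₁ + T₂) - (ℓ - m - 1))) * T₂
        + 2 * (a + M * (2 * (2 * d + 1)) *
            (8 * J ^ 2 * Real.exp (4 * velocity d J * T₁ - m + 1)) * T₁) * T₂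
        + 5 * Real.exp (-(γ * T₂ / 2))
        + 2 * (M * (2 * (2 * d + 1)) *
            (8 * J ^ 2 * Real.exp (4 * velocity d J * T₁ - m + 1)) * T₁
          + 5 * Real.exp (-(γ * T₁ / 2)) * (M * (2 * (2 * d + 1)) * (2 * J ^ 2)) / γ) / a := by
  classical
  have : Nonempty (Config n) := nonempty_of_norm_eq_one hψ.1
  have hHsa := hΦ.isSelfAdjoint_hamiltonian
  obtain ⟨E, hgap, hker⟩ := hψ.exists_energy hHsa
  have hP := isStarProjection_rankOneProj hψ.1
  obtain ⟨ν₁, hν₁p, hν₁T, hν₁⟩ := exists_filter hγ hT₁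
  obtain ⟨ν₂, hν₂p, hν₂T, hν₂⟩ := exists_filter hγ hT₂
  set H₀ := hamiltonian Φ with hH₀
  set I₀ := ∑ Z ∈ deepRegions A A m, Φ Z with hI₀
  set E₀ := ∑ Z ∈ deepRegions A Aᶜ m, Φ Z with hE₀
  set B₀ := ∑ Z ∈ nearRegions A m, Φ Z with hB₀
  have hI₀sa : IsSelfAdjoint I₀ := isSelfAdjoint_sum _ hΦ.selfAdjoint
  have hE₀sa : IsSelfAdjoint E₀ := isSelfAdjoint_sum _ hΦ.selfAdjoint
  obtain ⟨cI, hcI⟩ := exists_rankOneProj_mul_mul ψ hI₀sa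
  obtain ⟨cE, hcE⟩ := exists_rankOneProj_mul_mul ψ hE₀sa
  set P := rankOneProj ψ
  -- shift the energies so that all ground state expectations vanish
  set H := H₀ - (E : ℂ) • (1 : Observable n) with hHdef
  set HI := I₀ - (cI : ℂ) • (1 : Observable n) with hHI
  set HE := E₀ - (cE : ℂ) • (1 : Observable n) with hHE
  set HB := B₀ - ((E - cI - cE : ℝ) : ℂ) • (1 : Observable n) with hHB
  have hH : IsSelfAdjoint H := hHsa.sub (isSelfAdjoint_real_smul_one E)
  have hHIsa : IsSelfAdjoint HI := hI₀sa.sub (isSelfAdjoint_real_smul_one cI)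
  have hHEsa : IsSelfAdjoint HE := hE₀sa.sub (isSelfAdjoint_real_smul_one cE)
  have hsum : H = HI + HE + HB := by
    have h1 : H₀ = I₀ + E₀ + B₀ := sum_regions A m Φ
    rw [hHdef, h1, hHI, hHE, hHB]
    push_cast
    rw [sub_smul, sub_smul]
    abel
  have hHP : H * P = 0 := by
    rw [← hker]; exact mul_kerProj hH (finite_spectrum H)
  obtain ⟨R, hR, hRn⟩ := exists_resolvent hH (finite_spectrum H)
  replace hRn := hRn γ hγ hgap
  rw [hker] at hR
  have hηpos : ∀ T : ℝ, 0 ≤ 5 * Real.exp (-(γ * T / 2)) := fun T => by positivity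
  have hf₁ := norm_integral_expI_sub_kerProj_le hH (finite_spectrum H) (hηpos T₁) hgap ν₁ hν₁
  have hf₂ := norm_integral_expI_sub_kerProj_le hH (finite_spectrum H) (hηpos T₂) hgap ν₂ hν₂
  rw [hker] at hf₁ hf₂
  have hPP : P * P = P := hP.isIdempotentElem
  have hI0 : P * HI * P = 0 := by
    rw [hHI, mul_sub, sub_mul, hcI, mul_smul_comm, mul_one, smul_mul_assoc, hPP, sub_self]
  have hE0 : P * HE * P = 0 := by
    rw [hHE, mul_sub, sub_mul, hcE, mul_smul_comm, mul_one, smul_mul_assoc, hPP, sub_self]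
  set N := M * (2 * (2 * d + 1)) * (2 * J ^ 2)
  set δ := M * (2 * (2 * d + 1)) *
    (8 * J ^ 2 * Real.exp (4 * velocity d J * T₁ - m + 1)) * T₁
  set κ := M * (2 * J * Real.exp (4 * velocity d J * (T₁ + T₂) - (ℓ - m - 1)))
  obtain ⟨hIN₀, hIW⟩ := hΦ.deepRegions_bounds hd hJ hA (Or.inl rfl) (T := T₁) hM
  obtain ⟨hEN₀, hEW⟩ := hΦ.deepRegions_bounds hd hJ hA (Or.inr rfl) (T := T₁) hM
  have hIN : ‖⁅H, HI⁆‖ ≤ N := by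
    rw [hHdef, hHI, lie_sub_smul_one_left, lie_sub_smul_one_right]; exact hIN₀
  have hEN : ‖⁅H, HE⁆‖ ≤ N := by
    rw [hHdef, hHE, lie_sub_smul_one_left, lie_sub_smul_one_right]; exact hEN₀
  have hheis : ∀ (b W : Observable n) (c t : ℝ),
      ⁅heis H t (b - (c : ℂ) • 1), W⁆ = ⁅heis H₀ t b, W⁆ := fun b W c t => by
    rw [heis_sub_smul_one_right, lie_sub_smul_one_left, hHdef, heis_sub_smul_one]
  obtain ⟨MI, hMIA, -, hMIδ, hMI⟩ := exists_mem_localAlgebra_of_norm_lie_le A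
    (timeAverage ν₁ H HI) (δ := δ) fun W hW hWA =>
      norm_lie_timeAverage_le hH ν₁ hν₁T fun t ht => by
        rw [hHI, hheis]; exact hIW W hW hWA t ht
  obtain ⟨ME, hMEA, -, hMEδ, hME⟩ := exists_mem_localAlgebra_of_norm_lie_le Aᶜ
    (timeAverage ν₁ H HE) (δ := δ) fun W hW hWA =>
      norm_lie_timeAverage_le hH ν₁ hν₁T fun t ht => by
        rw [hHE, hheis]; exact hEW W hW hWA t ht
  have hKI := isSelfAdjoint_timeAverage hH ν₁ hHIsa
  have hKE := isSelfAdjoint_timeAverage hH ν₁ hHEsa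
  obtain ⟨Q, hQB, hQn, hQκ, -⟩ := exists_mem_localAlgebra_of_norm_lie_le (boundaryNhd A ℓ)
    (∫ t, expI H t * expI (timeAverage ν₁ H HI + timeAverage ν₁ H HE) (-t) ∂ν₂)
    (δ := κ * T₂) fun W hW hWB =>
      norm_lie_integral_expI_mul_expI_le hH hHIsa hHEsa hsum ν₁ ν₂ hν₁T hν₂T fun s hs => by
        rw [hHB, hheis]
        refine (hΦ.norm_lie_heis_sum_le_card hd hJ hW hWB (stepLipschitz_sub_bdDist hA ℓ) ?_
          (m := ℓ - m - 1) ?_ hs).trans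
            (mul_le_mul_of_nonneg_right hM (by positivity))
        · intro x hx
          obtain ⟨y, hy, hxy⟩ := exists_latticeDist_eq_bdDist hA x
          have h1 : x ∉ boundaryNhd A ℓ := Finset.mem_compl.1 hx
          simp only [boundaryNhd, Finset.mem_filter, Finset.mem_univ, true_and, not_exists,
            not_and, not_le] at h1
          have h2 := h1 y hy
          rw [hxy] at h2
          linarith
        · intro Z hZ hne hZd
          obtain ⟨x, hx, hxm⟩ := exists_bdDist_le_of_mem_nearRegions hm hZ hZd hne
          refine le_minOn hne fun y hy => ?_
          have h1 : (bdDist A y : ℝ) ≤ bdDist A x + 1 := by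
            exact_mod_cast bdDist_le_add_one hA ((latticeDist_le_diam hy hx).trans hZd)
          linarith
  have hPA := cfc_mem_localAlgebra hMIA (hMI hKI) fun z : ℂ => if ‖z‖ ≤ a then 1 else 0
  have hPE := cfc_mem_localAlgebra hMEA (hME hKE) fun z : ℂ => if ‖z‖ ≤ a then 1 else 0
  have hnI : IsStarNormal MI := (hMI hKI).isStarNormal
  have hnE : IsStarNormal ME := (hME hKE).isStarNormal
  refine ⟨spectralProj a MI, hPA, spectralProj a ME, hPE, Q, hQB,
    isStarProjection_cfc (finite_spectrum _) _, isStarProjection_cfc (finite_spectrum _) _,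
    hQn.trans (norm_integral_expI_mul_expI_le hH (hKI.add hKE) ν₂), ?_⟩
  exact norm_mul_spectralProj_sub_le hH hHIsa hHEsa hP hHP hγ ha (hηpos T₁) hR hRn ν₁ ν₂ hf₁ hf₂
    hν₂T hI0 hE0 hIN hEN (hMI hKI) (hME hKE) finite_spectrum hMIδ hMEδ
    (commute_of_mem_localAlgebra_compl hPA hPE) hQκ

end Approximation

/-! ### Regions without boundary -/

section Decoupled

open Complex

variable {d : ℕ} {V : Finset (Fin d → ℤ)} {n : V → ℕ} {Φ : Finset V → Observable n} {γ J : ℝ}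

set_option maxHeartbeats 1000000 in
/-- Without boundary the two sides do not interact, and the ground state projection is a product of
eigenprojections of the two Hamiltonians. -/
theorem exists_mul_eq_rankOneProj_of_boundary_eq_empty (hΦ : IsInteraction n Φ J)
    {ψ : EuclideanSpace ℂ (Config n)} (hψ : IsGappedGroundState (hamiltonian Φ) ψ γ)
    {A : Finset V} (hA : boundary A = ∅) :
    ∃ PA ∈ localAlgebra n A, ∃ PAc ∈ localAlgebra n Aᶜ,
      IsStarProjection PA ∧ IsStarProjection PAc ∧ PA * PAc = rankOneProj ψ := by
  classical
  have : Nonempty (Config n) := nonempty_of_norm_eq_one hψ.1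
  have hHsa := hΦ.isSelfAdjoint_hamiltonian
  obtain ⟨E, hgap, hker⟩ := hψ.exists_energy hHsa
  have hP := isStarProjection_rankOneProj hψ.1
  set I₀ := ∑ Z with Z ⊆ A, Φ Z with hI₀
  set E₀ := ∑ Z with ¬ Z ⊆ A, Φ Z with hE₀
  have hI₀sa : IsSelfAdjoint I₀ := isSelfAdjoint_sum _ hΦ.selfAdjoint
  have hE₀sa : IsSelfAdjoint E₀ := isSelfAdjoint_sum _ hΦ.selfAdjoint
  have hI₀A : I₀ ∈ localAlgebra n A := sum_mem_localAlgebra fun Z hZ =>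
    localAlgebra_mono (Finset.mem_filter.1 hZ).2 (hΦ.mem_local Z)
  have hE₀A : E₀ ∈ localAlgebra n Aᶜ := sum_mem_localAlgebra fun Z hZ => by
    -- a nonzero term that is not inside `A` cannot meet `A`, since `∂A` is empty
    by_cases h0 : Φ Z = 0
    · rw [h0, ← zero_smul ℂ (1 : Observable n)]
      exact smul_mem_localAlgebra 0 (one_mem_localAlgebra _)
    refine localAlgebra_mono (fun x hx => Finset.mem_compl.2 fun hxA => ?_) (hΦ.mem_local Z)
    obtain ⟨y, hy, hyA⟩ := Finset.not_subset.1 (Finset.mem_filter.1 hZ).2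
    have : x ∈ boundary A := mem_boundary.2
      ⟨hxA, y, hyA, (latticeDist_le_diam hx hy).trans (hΦ.diam_le_one h0)⟩
    rw [hA] at this
    exact Finset.notMem_empty x this
  -- shift both Hamiltonians so that the ground state is annihilated by each of them
  obtain ⟨c, hc⟩ := exists_rankOneProj_mul_mul ψ hI₀sa
  set P := rankOneProj ψ
  set H := hamiltonian Φ - (E : ℂ) • (1 : Observable n) with hHdef
  set HI := I₀ + ((-c : ℝ) : ℂ) • (1 : Observable n) with hHI
  set HE := E₀ + ((c - E : ℝ) : ℂ) • (1 : Observable n) with hHE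
  have hH : IsSelfAdjoint H := hHsa.sub (isSelfAdjoint_real_smul_one E)
  have hHIsa : IsSelfAdjoint HI := hI₀sa.add (isSelfAdjoint_real_smul_one _)
  have hHEsa : IsSelfAdjoint HE := hE₀sa.add (isSelfAdjoint_real_smul_one _)
  have hHIA : HI ∈ localAlgebra n A :=
    add_mem_localAlgebra hI₀A (smul_mem_localAlgebra _ (one_mem_localAlgebra _))
  have hHEA : HE ∈ localAlgebra n Aᶜ :=
    add_mem_localAlgebra hE₀A (smul_mem_localAlgebra _ (one_mem_localAlgebra _))
  have hsum : H = HI + HE := by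
    have h1 : hamiltonian Φ = I₀ + E₀ :=
      (Finset.sum_filter_add_sum_filter_not Finset.univ (fun Z => Z ⊆ A) Φ).symm
    rw [hHdef, h1, hHI, hHE]
    push_cast
    rw [sub_smul, neg_smul]
    abel
  have hHP : H * P = 0 := by
    rw [← hker]; exact mul_kerProj hH (finite_spectrum H)
  obtain ⟨R, hR, -⟩ := exists_resolvent hH (finite_spectrum H)
  rw [hker] at hR
  -- whatever `H` annihilates is in the range of `P`
  have hrange : ∀ {X : Observable n}, H * X = 0 → P * X = X := fun {X} hX => by
    have h1 : R * (H * X) = 0 := by rw [hX, mul_zero]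
    rw [← mul_assoc, hR, sub_mul, one_mul, sub_eq_zero] at h1
    exact h1.symm
  have hcomm : Commute HI H := by
    rw [hsum]
    exact (Commute.refl HI).add_right (commute_of_mem_localAlgebra_compl hHIA hHEA)
  have hIP : HI * P = 0 := by
    have h1 : P * (HI * P) = HI * P := hrange (by
      rw [← mul_assoc, ← hcomm.eq, mul_assoc, hHP, mul_zero])
    have hPP : P * P = P := hP.isIdempotentElem
    rw [← h1, ← mul_assoc, hHI, mul_add, add_mul, hc, mul_smul_comm, mul_one, smul_mul_assoc, hPP,
      ← add_smul]
    simp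
  have hEP : HE * P = 0 := by
    have h1 : HE = H - HI := by rw [hsum]; abel
    rw [h1, sub_mul, hHP, hIP, sub_zero]
  have hkerP : ∀ {M : Observable n}, IsSelfAdjoint M → M * P = 0 → kerProj M * P = P :=
    fun {M} hM hMP => by
      obtain ⟨R, hR, -⟩ := exists_resolvent hM (finite_spectrum M)
      have h1 : R * (M * P) = 0 := by rw [hMP, mul_zero]
      rw [← mul_assoc, hR, sub_mul, one_mul, sub_eq_zero] at h1
      exact h1.symm
  have hnI : IsStarNormal HI := hHIsa.isStarNormal
  have hnE : IsStarNormal HE := hHEsa.isStarNormal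
  have hp : IsStarProjection (kerProj HI) := isStarProjection_cfc (finite_spectrum _) _
  have hr : IsStarProjection (kerProj HE) := isStarProjection_cfc (finite_spectrum _) _
  have hpA : kerProj HI ∈ localAlgebra n A := cfc_mem_localAlgebra hHIA hHIsa _
  have hrA : kerProj HE ∈ localAlgebra n Aᶜ := cfc_mem_localAlgebra hHEA hHEsa _
  have hpr := commute_of_mem_localAlgebra_compl hpA hrA
  refine ⟨kerProj HI, hpA, kerProj HE, hrA, hp, hr, ?_⟩
  have h1 : P * (kerProj HI * kerProj HE) = kerProj HI * kerProj HE := by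
    refine hrange ?_
    rw [hsum, add_mul, ← mul_assoc, mul_kerProj hHIsa (finite_spectrum _), zero_mul, zero_add,
      hpr.eq, ← mul_assoc, mul_kerProj hHEsa (finite_spectrum _), zero_mul]
  have h2 : kerProj HE * (kerProj HI * P) = P := by
    rw [hkerP hHIsa hIP, hkerP hHEsa hEP]
  rw [← h1]
  have h3 := congrArg star h2
  rwa [star_mul, star_mul, hp.isSelfAdjoint.star_eq, hr.isSelfAdjoint.star_eq,
    hP.isSelfAdjoint.star_eq, mul_assoc] at h3

end Decoupled

/-! ### The numerical estimate -/

section Constants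

/-- An exponential in `q` beats the volume factors: `d`, `s` and `ℓ` are at most of the order of
`√q`, `q` and `q²`. -/
lemma volume_factor_le_exp {d : ℕ} (hd : 1 ≤ d) {s q : ℝ} (hs : 1 ≤ s)
    (hq : 14400 * (d : ℝ) ^ 2 * s ≤ q) :
    480 * (d : ℝ) ^ 2 * (25 * s * q) ^ d * s * q ^ 2 ≤ Real.exp (q / 10) := by
  have hd' : (1 : ℝ) ≤ d := by exact_mod_cast hd
  have hd2 : (1 : ℝ) ≤ (d : ℝ) ^ 2 := one_le_pow₀ hd'
  have hq1 : 14400 ≤ q := by nlinarith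
  have hsq : 14400 * s ≤ q := by nlinarith
  have hdq : 14400 * (d : ℝ) ^ 2 ≤ q := by nlinarith
  have hq0 : 0 < q := by linarith
  have h1 : 25 * s * q ≤ q ^ 2 := by nlinarith
  have h2 : 480 * (d : ℝ) ^ 2 * s ≤ q ^ 2 := by nlinarith
  have h3 : 480 * (d : ℝ) ^ 2 * (25 * s * q) ^ d * s * q ^ 2 ≤ q ^ (6 * d) := by
    calc 480 * (d : ℝ) ^ 2 * (25 * s * q) ^ d * s * q ^ 2
        = (480 * (d : ℝ) ^ 2 * s) * (25 * s * q) ^ d * q ^ 2 := by ring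
      _ ≤ q ^ 2 * (q ^ 2) ^ d * q ^ 2 := by gcongr
      _ = q ^ (2 * d + 4) := by rw [← pow_mul]; ring
      _ ≤ q ^ (6 * d) := pow_le_pow_right₀ (by linarith) (by omega)
  refine h3.trans ?_
  rw [← Real.exp_log (pow_pos hq0 _), Real.log_pow]
  refine Real.exp_le_exp.2 ?_
  -- `log q ≤ 2 √q` and `120 d ≤ √q`
  have hsqrt : (√q) ^ 2 = q := Real.sq_sqrt hq0.le
  have hlog : Real.log q ≤ 2 * √q := by
    rw [← hsqrt, Real.log_pow, hsqrt]
    have := Real.log_le_sub_one_of_pos (Real.sqrt_pos.2 hq0)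
    push_cast; linarith
  have hdsq : 120 * (d : ℝ) ≤ √q := by
    apply Real.le_sqrt_of_sq_le
    nlinarith
  push_cast
  have h4 : 0 ≤ √q := Real.sqrt_nonneg q
  calc 6 * (d : ℝ) * Real.log q ≤ 6 * d * (2 * √q) := by gcongr
    _ ≤ q / 10 := by nlinarith

/-- The sum of the errors in `exists_approx`, for cut-offs proportional to `q / γ`. -/
lemma sum_errors_le {γ J r q M D y e₁ e₂ : ℝ} (hγ : 0 < γ) (hJ : 0 < J) (hJr : 4 * J ≤ r * γ)
    (hq : 1 ≤ q) (hM : 1 ≤ M) (hD : 1 ≤ D) (hy : 0 < y) (hy1 : y ≤ 1) (h1 : 0 ≤ e₁)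
    (h1' : e₁ ≤ 3 * y) (h2 : 0 ≤ e₂) (h2' : e₂ ≤ 3 * y ^ 2) :
    M * (2 * J * e₁) * (2.2 * q / γ)
      + 2 * (γ * y + M * D * (8 * J ^ 2 * e₂) * (4.4 * q / γ)) * (2.2 * q / γ)
      + 5 * y
      + 2 * (M * D * (8 * J ^ 2 * e₂) * (4.4 * q / γ)
        + 5 * y ^ 2 * (M * D * (2 * J ^ 2)) / γ) / (γ * y)
      ≤ 60 * (M * D * (1 + r ^ 2) * q ^ 2 * y) := by
  obtain ⟨j, rfl⟩ : ∃ j, J = j * γ := ⟨J / γ, by field_simp⟩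
  have hj : 0 < j := pos_of_mul_pos_left hJ hγ.le
  have hjr : 4 * j ≤ r := by
    by_contra h
    nlinarith [not_le.1 h]
  set s := 1 + r ^ 2
  have hs : 1 ≤ s := by simp only [s]; nlinarith
  have hjs : 4 * j ≤ s := by simp only [s]; nlinarith [sq_nonneg (r - 1)]
  have hj2 : 16 * j ^ 2 ≤ s := by simp only [s]; nlinarith
  have hMD : 1 ≤ M * D := by nlinarith
  have hq2 : q ≤ q ^ 2 := by nlinarith
  -- every error is at most a multiple of the common majorant `X`
  set X := M * D * s * q ^ 2 * y with hX
  have t1 : M * (2 * (j * γ) * e₁) * (2.2 * q / γ) ≤ 3.3 * X := by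
    calc M * (2 * (j * γ) * e₁) * (2.2 * q / γ) = M * (4.4 * j) * q * e₁ := by field_simp; ring
      _ ≤ (M * D) * (4.4 * (s / 4)) * q ^ 2 * (3 * y) := by
          gcongr
          · nlinarith
          · linarith
      _ = 3.3 * X := by rw [hX]; ring
  have hδ : M * D * (8 * (j * γ) ^ 2 * e₂) * (4.4 * q / γ) ≤ γ * (7 * (M * D * s * q * y ^ 2)) := by
    calc M * D * (8 * (j * γ) ^ 2 * e₂) * (4.4 * q / γ)
        = γ * (M * D * (35.2 * j ^ 2) * q * e₂) := by field_simp; ring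
      _ ≤ γ * (M * D * (35.2 * (s / 16)) * q * (3 * y ^ 2)) := by gcongr; linarith
      _ ≤ _ := by
          rw [show M * D * (35.2 * (s / 16)) * q * (3 * y ^ 2) =
            6.6 * (M * D * s * q * y ^ 2) by ring]
          gcongr
          norm_num
  have t2 : 2 * (γ * y + M * D * (8 * (j * γ) ^ 2 * e₂) * (4.4 * q / γ)) * (2.2 * q / γ)
      ≤ 36 * X := by
    calc _ ≤ 2 * (γ * y + γ * (7 * (M * D * s * q * y ^ 2))) * (2.2 * q / γ) := by gcongr
      _ = 4.4 * (1 * 1 * q * y) + 30.8 * (M * D * s * q ^ 2 * y * y) := by field_simp; ring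
      _ ≤ 4.4 * (M * D * s * q ^ 2 * y) + 30.8 * (M * D * s * q ^ 2 * y * 1) := by gcongr
      _ ≤ 36 * X := by
          have : 0 < X := by positivity
          rw [← hX]; linarith
  have t3 : 5 * y ≤ 5 * X := by
    have : 1 * 1 * 1 * y ≤ M * D * s * q ^ 2 * y := by gcongr; nlinarith
    linarith
  have t4 : 2 * (M * D * (8 * (j * γ) ^ 2 * e₂) * (4.4 * q / γ)
        + 5 * y ^ 2 * (M * D * (2 * (j * γ) ^ 2)) / γ) / (γ * y) ≤ 15.25 * X := by
    calc _ ≤ 2 * (γ * (7 * (M * D * s * q * y ^ 2))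
          + 5 * y ^ 2 * (M * D * (2 * (j * γ) ^ 2)) / γ) / (γ * y) := by gcongr
      _ = 14 * (M * D * s * q * y) + 20 * (M * D * j ^ 2 * 1 * y) := by field_simp; ring
      _ ≤ 14 * (M * D * s * q ^ 2 * y) + 20 * (M * D * (s / 16) * q ^ 2 * y) := by
          gcongr
          · linarith
          · nlinarith
      _ = _ := by rw [hX]; ring
  have : 0 < X := by positivity
  linarith

lemma three_le_prefactor {d : ℕ} (hd : 1 ≤ d) {γ J : ℝ} (hγ : 0 < γ) (hJ : 0 < J) :
    3 ≤ prefactor γ d J := by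
  have hv : 0 < velocity d J := velocity_pos hd hJ
  have h1 : 0 ≤ const₁ γ d J := by unfold const₁; positivity
  have h2 : 3 ≤ const₂ γ d J := by unfold const₂; exact le_add_of_nonneg_left (by positivity)
  have h3 : 0 ≤ const₃ γ d J := by unfold const₃; positivity
  unfold prefactor
  linarith

/-- The sum of the errors fits under the bound of the theorem: a tenth of the exponential decay pays
for the volume factors. -/
lemma error_majorant_le {d : ℕ} (hd : 1 ≤ d) {s q b c y : ℝ} (hs : 1 ≤ s)
    (hq : 14400 * (d : ℝ) ^ 2 * s ≤ q) (hb : 1 ≤ b) (hc : 3 ≤ c) (hy : 0 ≤ y) :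
    60 * (b * (25 * s * q) ^ d * (2 * d + 2) * (2 * (2 * d + 1)) * s * q ^ 2 * y)
      ≤ c * b ^ 2 * (Real.exp (q / 10) * y) := by
  have hd' : (1 : ℝ) ≤ d := by exact_mod_cast hd
  have hq0 : 0 ≤ q := le_trans (by positivity) hq
  have hb2 : 3 * b ≤ c * b ^ 2 := by
    calc 3 * b ≤ c * b := by gcongr
      _ ≤ c * b ^ 2 := by gcongr; exact le_self_pow₀ hb two_ne_zero
  calc 60 * (b * (25 * s * q) ^ d * (2 * d + 2) * (2 * (2 * d + 1)) * s * q ^ 2 * y)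
      ≤ 60 * (b * (25 * s * q) ^ d * (4 * d) * (2 * (3 * d)) * s * q ^ 2 * y) := by
        gcongr <;> linarith
    _ = 3 * b * ((480 * (d : ℝ) ^ 2 * (25 * s * q) ^ d * s * q ^ 2) * y) := by ring
    _ ≤ c * b ^ 2 * (Real.exp (q / 10) * y) := by
        have := volume_factor_le_exp hd hs hq
        gcongr

end Constants

end SpinLattice

/-! ### Choice of the parameters -/

set_option maxHeartbeats 600000 in
open SpinLattice in
theorem mainTheorem4 :
    ∃ c₀ : ℝ, 0 < c₀ ∧
      ∀ (d : ℕ) (γ J : ℝ), 1 ≤ d → 0 < γ → 0 < J →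
      ∀ (V : Finset (Fin d → ℤ)) (n : V → ℕ) (Φ : Finset V → SpinLattice.Observable n)
        (Ψ₀ : EuclideanSpace ℂ (SpinLattice.Config n)),
        SpinLattice.IsInteraction n Φ J →
        SpinLattice.IsGappedGroundState (SpinLattice.hamiltonian Φ) Ψ₀ γ →
      ∀ (A : Finset V) (ℓ : ℝ), c₀ * (d : ℝ) ^ 2 * SpinLattice.decayLength γ d J ^ 2 ≤ ℓ →
      ∃ PA ∈ SpinLattice.localAlgebra n A,
      ∃ PAc ∈ SpinLattice.localAlgebra n Aᶜ,
      ∃ PB ∈ SpinLattice.localAlgebra n (SpinLattice.boundaryNhd A ℓ),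
        IsStarProjection PA ∧ IsStarProjection PAc ∧ ‖PB‖ ≤ 1 ∧
        ‖PB * PA * PAc - SpinLattice.rankOneProj Ψ₀‖ ≤
          SpinLattice.prefactor γ d J * ((SpinLattice.boundary A).card : ℝ) ^ 2
            * Real.exp (-ℓ / SpinLattice.decayLength γ d J) := by
  refine ⟨576, by norm_num, fun d γ J hd hγ hJ V n Φ ψ hΦ hψ A ℓ hℓ => ?_⟩
  rcases (boundary A).eq_empty_or_nonempty with hA | hA
  · obtain ⟨PA, hPA, PAc, hPAc, h1, h2, h3⟩ :=
      exists_mul_eq_rankOneProj_of_boundary_eq_empty hΦ hψ hA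
    have : Nonempty (Config n) := nonempty_of_norm_eq_one hψ.1
    refine ⟨PA, hPA, PAc, hPAc, 1, one_mem_localAlgebra _, h1, h2,
      norm_le_one_of_mem_unitary (one_mem _), ?_⟩
    rw [one_mul, h3, sub_self, norm_zero, hA]
    simp
  have hb : (1 : ℝ) ≤ ((boundary A).card : ℝ) := by exact_mod_cast hA.card_pos
  have hpre := three_le_prefactor hd hγ hJ
  have hv := velocity_pos hd hJ
  have hd' : (1 : ℝ) ≤ d := by exact_mod_cast hd
  obtain ⟨r, hr⟩ : ∃ r, velocity d J = r * γ := ⟨velocity d J / γ, by field_simp⟩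
  have hξ : decayLength γ d J = 25 * (1 + r ^ 2) := by
    rw [decayLength, hr, mul_div_cancel_right₀ _ hγ.ne']
  have hr0 : 0 < r := by
    rw [hr] at hv
    exact pos_of_mul_pos_left hv hγ.le
  have hJr : 4 * J ≤ r * γ := by
    rw [← hr, velocity]
    nlinarith
  rw [hξ] at hℓ ⊢
  set b : ℝ := ((boundary A).card : ℝ) with hbdef
  set s := 1 + r ^ 2 with hs
  have hs1 : 1 ≤ s := by simp only [hs]; nlinarith
  have hrs₁ : 17.6 * r ≤ 10.5 * s - 2.2 := by
    simp only [hs]; nlinarith [sq_nonneg (r - 0.85)]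
  have hrs₂ : 26.4 * r ≤ 14.5 * s - 1.1 := by
    simp only [hs]; nlinarith [sq_nonneg (r - 0.9)]
  -- measure lengths in units of the decay length
  obtain ⟨q, rfl⟩ : ∃ q, ℓ = 25 * s * q := ⟨ℓ / (25 * s), by field_simp⟩
  have hq : 14400 * (d : ℝ) ^ 2 * s ≤ q := by
    have h1 : 25 * s * (14400 * (d : ℝ) ^ 2 * s) ≤ 25 * s * q := by
      calc _ = 576 * (d : ℝ) ^ 2 * (25 * s) ^ 2 := by ring
        _ ≤ _ := hℓ
    exact le_of_mul_le_mul_left h1 (by positivity)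
  have hd2 : (1 : ℝ) ≤ (d : ℝ) ^ 2 := one_le_pow₀ hd'
  have hq1 : 14400 ≤ q := by nlinarith
  have hsq : q ≤ s * q := by nlinarith
  have hrq₁ : 17.6 * r * q ≤ (10.5 * s - 2.2) * q := by gcongr
  have hrq₂ : 26.4 * r * q ≤ (14.5 * s - 1.1) * q := by gcongr
  set y := Real.exp (-(1.1 * q)) with hy
  have hy2 : y ^ 2 = Real.exp (-(2.2 * q)) := by
    rw [hy, ← Real.exp_nat_mul]; congr 1; push_cast; ring
  have hy0 : 0 < y := Real.exp_pos _
  have hy1 : y ≤ 1 := Real.exp_le_one_iff.2 (by linarith)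
  have he3 : Real.exp 1 ≤ 3 := by linarith [Real.exp_one_lt_d9]
  have hγT₁ : γ * (4.4 * q / γ) = 4.4 * q := by field_simp
  have hγT₂ : γ * (2.2 * q / γ) = 2.2 * q := by field_simp
  have hvT₁ : 4 * velocity d J * (4.4 * q / γ) = 17.6 * (r * q) := by
    rw [hr]; field_simp; ring
  have hvT₂ : 4 * velocity d J * (4.4 * q / γ + 2.2 * q / γ) = 26.4 * (r * q) := by
    rw [hr]; field_simp; ring
  -- The cut-offs `T₁ = 4.4 q / γ` and `T₂ = 2.2 q / γ` make the filter errors `y ^ 2` and `y`: the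
  -- first one gets divided by the threshold `γ y`. The depth `m` exceeds the Lieb–Robinson
  -- spreading `17.6 r q` up to time `T₁`, and `ℓ - m` the spreading `26.4 r q` up to `T₁ + T₂`.
  set m := 10.5 * (s * q) with hm
  have hcard : (((nearRegions A m).filter fun Z => diam Z ≤ 1).card : ℝ)
      ≤ b * (25 * s * q) ^ d * (2 * d + 2) := by
    -- the side `2 m + 1` of the cubes around the boundary points is at most `ℓ`
    refine (card_nearRegions_le hA (by positivity)).trans ?_
    gcongr
    linarith
  obtain ⟨PA, hPA, PAc, hPAc, PB, hPB, h1, h2, h3, h4⟩ :=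
    exists_approx (ℓ := 25 * s * q) (m := m) (T₁ := 4.4 * q / γ) (T₂ := 2.2 * q / γ) (a := γ * y)
      hd hγ hJ hΦ hψ hA (by positivity) (by positivity) (by linarith) (by linarith) hcard
  refine ⟨PA, hPA, PAc, hPAc, PB, hPB, h1, h2, h3, h4.trans ?_⟩
  rw [hγT₁, hγT₂, hvT₁, hvT₂, show -(2.2 * q / 2) = -(1.1 * q) by ring, ← hy,
    show -(4.4 * q / 2) = -(2.2 * q) by ring, ← hy2]
  have he₁ : Real.exp (26.4 * (r * q) - (25 * s * q - m - 1)) ≤ 3 * y := by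
    calc _ ≤ Real.exp (1 + -(1.1 * q)) := Real.exp_le_exp.2 (by rw [hm]; linarith)
      _ = Real.exp 1 * y := Real.exp_add _ _
      _ ≤ 3 * y := by gcongr
  have he₂ : Real.exp (17.6 * (r * q) - m + 1) ≤ 3 * y ^ 2 := by
    calc _ ≤ Real.exp (1 + -(2.2 * q)) := Real.exp_le_exp.2 (by rw [hm]; linarith)
      _ = Real.exp 1 * y ^ 2 := by rw [Real.exp_add, hy2]
      _ ≤ 3 * y ^ 2 := by gcongr
  have hℓ1 : 1 ≤ (25 * s * q) ^ d := one_le_pow₀ (by nlinarith)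
  have hM1 : 1 ≤ b * (25 * s * q) ^ d * (2 * d + 2) :=
    one_le_mul_of_one_le_of_one_le (one_le_mul_of_one_le_of_one_le hb hℓ1) (by linarith)
  refine (sum_errors_le hγ hJ hJr (by linarith) hM1 (by linarith) hy0 hy1 (Real.exp_pos _).le he₁
    (Real.exp_pos _).le he₂).trans ?_
  have hexp : Real.exp (-(25 * s * q) / (25 * s)) = Real.exp (q / 10) * y := by
    rw [hy, ← Real.exp_add]
    congr 1
    field_simp
    ring
  rw [hexp]
  exact error_majorant_le hd hs1 hq hb hpre hy0.le
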